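/- Let $(X,\mathsf d)$ be a complete separable metric space and let $\mathfrak m$ be a locally finite Borel measure on $X$. Denote by $\mathrm{Geo}(X)$ the set of constant speed geodesics $\gamma\colon[0,1]\to X$, i.e. of curves with $\mathsf d(\gamma_s,\gamma_t)=|s-t|\,\mathsf d(\gamma_0,\gamma_1)$ for all $s,t\in[0,1]$, with the metric $\mathsf d^*(\gamma,\tilde\gamma)=\max_{t}\mathsf d(\gamma_t,\tilde\gamma_t)$ and its Borel $\sigma$-algebra, and put $\mathrm e_t(\gamma)=\gamma_t$. Assume that $X$ is geodesic: any two points of $X$ are the endpoints of some $\gamma\in\mathrm{Geo}(X)$. Let $\mathscr P_2(X)$ be the set of Borel probability measures on $X$ with finite second moment, and let $W_2(\mu_0,\mu_1)^2=\inf_\sigma\int_{X\times X}\mathsf d(x,y)^2\,d\sigma(x,y)$, the infimum being over all probability measures $\sigma$ on $X\times X$ with marginals $\mu_0$ and $\mu_1$. For $\mu_0,\mu_1\in\mathscr P_2(X)$ let $\mathrm{OptGeo}(\mu_0,\mu_1)$ be the set of Borel probability measures $\pi$ on $\mathrm{Geo}(X)$ such that $(\mathrm e_0,\mathrm e_1)_\#\pi$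 is an optimal plan, that is, it has marginals $\mu_0$ and $\mu_1$ and attains this infimum. The entropy of a probability measure $\mu$ is $\mathrm{Ent}_{\mathfrak m}(\mu)=\int_X\rho\log\rho\,d\mathfrak m\in[-\infty,\infty)$ if $\mu=\rho\,\mathfrak m$ and the positive part of $\rho\log\rho$ is $\mathfrak m$-integrable, and $\mathrm{Ent}_{\mathfrak m}(\mu)=\infty$ otherwise. Let $K\in\mathbb R$ and suppose that $(X,\mathsf d,\mathfrak m)$ is a strong $CD(K,\infty)$-space: for all $\mu_0,\mu_1\in\mathscr P_2(X)$ and all $\pi\in\mathrm{OptGeo}(\mu_0,\mu_1)$, with $\mu_t=(\mathrm e_t)_\#\pi$, $$\mathrm{Ent}_{\mathfrak m}(\mu_t)\le(1-t)\,\mathrm{Ent}_{\mathfrak m}(\mu_0)+t\,\mathrm{Ent}_{\mathfrak m}(\mu_1)-\frac K2\,t(1-t)\,W_2(\mu_0,\mu_1)^2\qquad\text{for all }t\in[0,1],$$ where nothing is required if $\mathrm{Ent}_{\mathfrak m}(\mu_0)=\infty$ or $\mathrm{Ent}_{\mathfrak m}(\mu_1)=\infty$. Then $(X,\mathsf d,\mathfrak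 m)$ is essentially non-branching: for all $\mu_0,\mu_1\in\mathscr P_2(X)$ that are absolutely continuous with respect to $\mathfrak m$ and every $\pi\in\mathrm{OptGeo}(\mu_0,\mu_1)$ there is a Borel set $\Gamma\subset\mathrm{Geo}(X)$ with $\pi(\Gamma)=1$ that is non-branching, i.e. whenever $\gamma,\tilde\gamma\in\Gamma$ satisfy $\gamma_s=\tilde\gamma_s$ for all $s\in[0,t]$ for some $t\in(0,1)$, then $\gamma=\tilde\gamma$. -/

import Mathlib

noncomputable section

open MeasureTheory Set
open scoped ENNReal unitInterval

namespace OptTransport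

/-- `Geo X`: the constant speed geodesics of `X` parametrized by the unit interval `I = [0,1]`,
a subset of the space `C(I, X)` of continuous curves, with the metric
`d*(γ, η) = max_t d(γ_t, η_t)` of that space. -/
abbrev Geo (X : Type*) [MetricSpace X] : Type _ :=
  {γ : C(I, X) // ∀ s t : I, dist (γ s) (γ t) = |(s : ℝ) - (t : ℝ)| * dist (γ 0) (γ 1)}

section GeoBasics

variable {X : Type*} [MetricSpace X]

instance : CoeFun (Geo X) (fun _ => I → X) := ⟨fun γ => γ.1⟩

/-- `Geo X` carries the Borel σ-algebra of the metric `d*`. -/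
instance : MeasurableSpace (Geo X) := borel (Geo X)

instance : BorelSpace (Geo X) := ⟨rfl⟩

/-- The evaluation map `e_t : γ ↦ γ_t`. -/
def Geo.eval (t : I) (γ : Geo X) : X := γ t

theorem Geo.continuous_eval (t : I) : Continuous (Geo.eval (X := X) t) :=
  (continuous_eval_const t).comp continuous_subtype_val

theorem Geo.measurable_eval [MeasurableSpace X] [BorelSpace X] (t : I) :
    Measurable (Geo.eval (X := X) t) :=
  (Geo.continuous_eval t).measurable

end GeoBasics

/-- `X` is a geodesic space: any two points are joined by a constant speed geodesic. -/
def IsGeodesicSpace (X : Type*) [MetricSpace X] : Prop :=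
  ∀ x y : X, ∃ γ : Geo X, γ 0 = x ∧ γ 1 = y

/-- A set `Γ` of geodesics is non-branching if two of its members that agree on `[0,t]` for some
`t ∈ (0,1)` are equal. -/
def IsNonBranching {X : Type*} [MetricSpace X] (Γ : Set (Geo X)) : Prop :=
  ∀ γ ∈ Γ, ∀ η ∈ Γ, (∃ t ∈ Ioo (0 : I) 1, ∀ s ∈ Icc (0 : I) t, γ s = η s) → γ = η

section Measures

variable {X : Type*} [MetricSpace X] [MeasurableSpace X]

/-- The class `P₂(X)` of probability measures with finite second moment. -/
structure IsP2 (μ : Measure X) : Prop where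
  isProbabilityMeasure : IsProbabilityMeasure μ
  secondMoment : ∃ x₀ : X, ∫⁻ x, edist x x₀ ^ 2 ∂μ < ∞

/-- `q` is a transport plan from `μ` to `ν`. -/
structure IsPlan (q : Measure (X × X)) (μ ν : Measure X) : Prop where
  isProbabilityMeasure : IsProbabilityMeasure q
  map_fst : q.map Prod.fst = μ
  map_snd : q.map Prod.snd = ν

/-- The quadratic transport cost `∫ d(x,y)² dq(x,y)` of a plan. -/
def cost (q : Measure (X × X)) : ℝ≥0∞ := ∫⁻ p, edist p.1 p.2 ^ 2 ∂q

/-- The squared Wasserstein distance `W₂(μ, ν)²`: the infimum of the transport cost. It is finite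
if `μ` and `ν` have finite second moments. -/
def W2sq (μ ν : Measure X) : ℝ≥0∞ := ⨅ (q : Measure (X × X)) (_ : IsPlan q μ ν), cost q

/-- `q` is an optimal plan from `μ` to `ν`. -/
def IsOptimalPlan (q : Measure (X × X)) (μ ν : Measure X) : Prop :=
  IsPlan q μ ν ∧ cost q = W2sq μ ν

/-- `OptGeo μ₀ μ₁`: the probability measures `π` on `Geo X` for which `(e₀, e₁)_# π` is an optimal
plan from `μ₀` to `μ₁`. -/
def OptGeo (μ₀ μ₁ : Measure X) : Set (Measure (Geo X)) :=
  {π | IsProbabilityMeasure π ∧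
    IsOptimalPlan (π.map fun γ => (Geo.eval 0 γ, Geo.eval 1 γ)) μ₀ μ₁}

/-- The integrand `ρ log ρ` of the entropy, where `ρ` is the density of `μ` with respect
to `m`. -/
def entDensity (m μ : Measure X) (x : X) : ℝ :=
  (μ.rnDeriv m x).toReal * Real.log (μ.rnDeriv m x).toReal

open Classical in
/-- The entropy of `μ` relative to `m`, with values in `[-∞, ∞]`: it is `∫ ρ log ρ dm` if
`μ = ρ m` and the positive part of `ρ log ρ` is integrable (the value is `-∞` if the negative part
is not integrable), and `∞` otherwise. -/
def Ent (m μ : Measure X) : EReal :=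
  if μ ≪ m ∧ ∫⁻ x, ENNReal.ofReal (entDensity m μ x) ∂m < ∞ then
    ((∫⁻ x, ENNReal.ofReal (entDensity m μ x) ∂m : ℝ≥0∞) : EReal)
      - ((∫⁻ x, ENNReal.ofReal (-entDensity m μ x) ∂m : ℝ≥0∞) : EReal)
  else ⊤

/-- `K`-convexity of the entropy along the curve `t ↦ (e_t)_# π` from `μ₀` to `μ₁`. If an endpoint
has entropy `∞`, nothing is required: the right-hand side is then `∞`, or has the
form `∞ - ∞`, for which `EReal` addition would give `-∞`. -/
def EntKConvexAlong (K : ℝ) (m μ₀ μ₁ : Measure X) (π : Measure (Geo X)) : Prop :=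
  Ent m μ₀ ≠ ⊤ → Ent m μ₁ ≠ ⊤ → ∀ t : I,
    Ent m (π.map (Geo.eval t)) ≤
      ((1 - (t : ℝ) : ℝ) : EReal) * Ent m μ₀ + ((t : ℝ) : EReal) * Ent m μ₁
        - ((K / 2 * (t : ℝ) * (1 - (t : ℝ)) * (W2sq μ₀ μ₁).toReal : ℝ) : EReal)

/-- The strong `CD(K,∞)` condition for `(X, d, m)`. -/
def IsStrongCD (K : ℝ) (m : Measure X) : Prop :=
  ∀ μ₀ μ₁ : Measure X, IsP2 μ₀ → IsP2 μ₁ →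
    ∀ π ∈ OptGeo μ₀ μ₁, EntKConvexAlong K m μ₀ μ₁ π

/-- `π` is concentrated on a (Borel) set of non-branching geodesics. -/
def ConcentratedOnNonBranching (π : Measure (Geo X)) : Prop :=
  ∃ Γ : Set (Geo X), MeasurableSet Γ ∧ IsNonBranching Γ ∧ π Γ = 1

/-- `(X, d, m)` is essentially non-branching. -/
def IsEssentiallyNonBranching (m : Measure X) : Prop :=
  ∀ μ₀ μ₁ : Measure X, IsP2 μ₀ → IsP2 μ₁ → μ₀ ≪ m → μ₁ ≪ m →
    ∀ π ∈ OptGeo μ₀ μ₁, ConcentratedOnNonBranching π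

end Measures

end OptTransport

end

/-! Branching costs entropy. Let two optimal dynamical plans have the same marginal at time `s` and
mutually singular marginals at a later time `s'`. Their equal mixture has that same marginal at `s`,
while its entropy at `s'` is lower by `log 2` than the mean of the two. Convexity on `[s, 1]` limits
how much the entropy of each plan can rise from `s` to `s'`, and convexity on `[0, s']` limits how
much that of the mixture can fall. Both limits are of order `s' - s`, so the loss of `log 2` is
impossible over a short time (`IsTame.log_two_le_of_branching`). The strong form of the condition is
what allows convexity to be tested on all three plans.

If the plans have density at most `M` with respect to a fixed plan `P`, the constant grows only like
`log M`. Suppose that, with probability at least `δ`, the position at `s` leaves both outcomes of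
`γ_{s'} ∈ A` a conditional probability of at least `δ`. Reweighting `P` then yields a forbidden pair
with `M = δ⁻²`. Hence the position at `s` predicts the event up to an error `3δ` once `(s' - s) log
(1/δ)` is small (`IsTame.exists_measure_symmDiff_le`). Chaining `N` equal steps with `δ = N⁻²` gives
a total error `3/N`, so the position at one time determines later ones almost surely
(`IsTame.exists_ae_mem_iff`). Countably many times and basic open sets then suffice to exclude
branching.

The estimates need bounded densities and a set of finite measure and bounded diameter; conditioning
`π` on an increasing sequence of sets of geodesics provides them. -/

namespace OptTransport

open MeasureTheory Set ProbabilityTheory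
open scoped ENNReal unitInterval symmDiff

set_option linter.unusedSectionVars false

/-! ### Optimal plans: domination and intermediate points -/

section Plans

variable {X : Type*} [MetricSpace X] [MeasurableSpace X]

lemma IsPlan.swap {q : Measure (X × X)} {μ ν : Measure X} (h : IsPlan q μ ν) :
    IsPlan (q.map Prod.swap) ν μ where
  isProbabilityMeasure := by
    have := h.isProbabilityMeasure
    exact Measure.isProbabilityMeasure_map measurable_swap.aemeasurable
  map_fst := by
    rw [Measure.map_map measurable_fst measurable_swap]
    exact h.map_snd
  map_snd := by
    rw [Measure.map_map measurable_snd measurable_swap]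
    exact h.map_fst

variable [BorelSpace X] [SecondCountableTopology X]

lemma measurable_edist_sq : Measurable fun p : X × X => edist p.1 p.2 ^ 2 :=
  (measurable_edist (α := X)).pow_const 2

lemma cost_map_swap (q : Measure (X × X)) : cost (q.map Prod.swap) = cost q := by
  rw [cost, lintegral_map measurable_edist_sq measurable_swap]
  simp [cost, edist_comm]

lemma W2sq_le_cost {q : Measure (X × X)} {μ ν : Measure X} (h : IsPlan q μ ν) :
    W2sq μ ν ≤ cost q := iInf₂_le q h

lemma W2sq_comm_le (μ ν : Measure X) : W2sq μ ν ≤ W2sq ν μ :=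
  le_iInf₂ fun q hq => (W2sq_le_cost hq.swap).trans_eq (cost_map_swap q)

lemma W2sq_comm (μ ν : Measure X) : W2sq μ ν = W2sq ν μ :=
  (W2sq_comm_le μ ν).antisymm (W2sq_comm_le ν μ)

lemma IsOptimalPlan.swap {q : Measure (X × X)} {μ ν : Measure X} (h : IsOptimalPlan q μ ν) :
    IsOptimalPlan (q.map Prod.swap) ν μ :=
  ⟨h.1.swap, by rw [cost_map_swap, h.2, W2sq_comm]⟩

lemma isOptimalPlan_of_forall_le {q : Measure (X × X)} {μ ν : Measure X} (h : IsPlan q μ ν)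
    (hle : ∀ q', IsPlan q' μ ν → cost q ≤ cost q') : IsOptimalPlan q μ ν :=
  ⟨h, (le_iInf₂ hle).antisymm (W2sq_le_cost h)⟩

lemma isPlan_prod {μ ν : Measure X} [IsProbabilityMeasure μ] [IsProbabilityMeasure ν] :
    IsPlan (μ.prod ν) μ ν where
  isProbabilityMeasure := inferInstance
  map_fst := by simp [Measure.map_fst_prod]
  map_snd := by simp [Measure.map_snd_prod]

lemma add_sq_le_two_mul (a b : ℝ≥0∞) : (a + b) ^ 2 ≤ 2 * (a ^ 2 + b ^ 2) := by
  have h := ENNReal.rpow_add_le_mul_rpow_add_rpow a b (p := 2) (by norm_num)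
  norm_num at h
  exact_mod_cast h

lemma W2sq_lt_top {μ ν : Measure X} (hμ : IsP2 μ) (hν : IsP2 ν) : W2sq μ ν < ∞ := by
  have := hμ.isProbabilityMeasure
  have := hν.isProbabilityMeasure
  obtain ⟨x, hx⟩ := hμ.secondMoment
  obtain ⟨y, hy⟩ := hν.secondMoment
  refine (W2sq_le_cost isPlan_prod).trans_lt ?_
  have hle : ∀ p : X × X, edist p.1 p.2 ^ 2
      ≤ 2 * (edist p.1 x ^ 2 + 2 * (edist x y ^ 2 + edist p.2 y ^ 2)) := fun p => by
    have h1 : edist p.1 p.2 ≤ edist p.1 x + (edist x y + edist p.2 y) := by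
      rw [edist_comm p.2 y]
      exact (edist_triangle _ x _).trans (add_le_add le_rfl (edist_triangle _ y _))
    calc edist p.1 p.2 ^ 2 ≤ (edist p.1 x + (edist x y + edist p.2 y)) ^ 2 := by gcongr
      _ ≤ _ := (add_sq_le_two_mul _ _).trans (by gcongr; exact add_sq_le_two_mul _ _)
  have hm (z : X) : Measurable fun w : X => edist w z ^ 2 :=
    (measurable_id.edist measurable_const).pow_const 2
  calc cost (μ.prod ν) ≤ ∫⁻ p, 2 * (edist p.1 x ^ 2 + 2 * (edist x y ^ 2 + edist p.2 y ^ 2))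
        ∂(μ.prod ν) := lintegral_mono hle
    _ = 2 * (∫⁻ w, edist w x ^ 2 ∂μ + 2 * (edist x y ^ 2 + ∫⁻ w, edist w y ^ 2 ∂ν)) := by
        have h1 : ∫⁻ p, edist p.1 x ^ 2 ∂(μ.prod ν) = ∫⁻ w, edist w x ^ 2 ∂μ := by
          rw [← lintegral_map (hm x) measurable_fst, Measure.map_fst_prod]; simp
        have h2 : ∫⁻ p, edist p.2 y ^ 2 ∂(μ.prod ν) = ∫⁻ w, edist w y ^ 2 ∂ν := by
          rw [← lintegral_map (hm y) measurable_snd, Measure.map_snd_prod]; simp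
        rw [lintegral_const_mul' _ _ (by simp),
          lintegral_add_left (f := fun p : X × X => edist p.1 x ^ 2) ((hm x).comp measurable_fst),
          lintegral_const_mul' _ _ (by simp), lintegral_add_left measurable_const, h1, h2]
        simp
    _ < ∞ := by
        have := edist_ne_top x y
        finiteness

lemma IsOptimalPlan.cost_lt_top {q : Measure (X × X)} {μ ν : Measure X}
    (h : IsOptimalPlan q μ ν) (hμ : IsP2 μ) (hν : IsP2 ν) : cost q < ∞ :=
  h.2 ▸ W2sq_lt_top hμ hν

/-- A plan that is dominated by a multiple of an optimal plan is optimal. -/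
lemma IsOptimalPlan.of_le_smul {p q : Measure (X × X)} {μ ν : Measure X}
    (hp : IsOptimalPlan p μ ν) (hfin : cost p < ∞) [IsProbabilityMeasure q] {M : ℝ≥0∞}
    (hM0 : M ≠ 0) (hM : M ≠ ∞) (hq : q ≤ M • p) :
    IsOptimalPlan q (q.map Prod.fst) (q.map Prod.snd) := by
  have hpp := hp.1.isProbabilityMeasure
  refine isOptimalPlan_of_forall_le ⟨inferInstance, rfl, rfl⟩ fun q' hq' => ?_
  have hq'p := hq'.isProbabilityMeasure
  have hMi : M⁻¹ ≠ ∞ := ENNReal.inv_ne_top.2 hM0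
  have hMi0 : M⁻¹ ≠ 0 := ENNReal.inv_ne_zero.2 hM
  have hle : M⁻¹ • q ≤ p := by
    intro s
    have := hq s
    simp only [Measure.smul_apply, smul_eq_mul] at this ⊢
    rwa [ENNReal.inv_mul_le_iff hM0 hM]
  have : IsFiniteMeasure (M⁻¹ • q) := q.smul_finite hMi
  -- Exchanging the part `M⁻¹ • q` of `p` for `M⁻¹ • q'` keeps both marginals, so the result
  -- competes with `p`; finiteness of the cost of `r` then allows cancellation.
  set r := p - M⁻¹ • q with hr
  have hsum : r + M⁻¹ • q = p := Measure.sub_add_cancel_of_le hle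
  have hmarg (f : X × X → X) (hf : Measurable f) (h : q'.map f = q.map f) :
      (r + M⁻¹ • q').map f = p.map f := by
    rw [← hsum, Measure.map_add _ _ hf, Measure.map_add _ _ hf, Measure.map_smul,
      Measure.map_smul, h]
  have hmass : (r + M⁻¹ • q') univ = p univ := by
    rw [← hsum]; simp
  have hplan : IsPlan (r + M⁻¹ • q') μ ν := by
    refine ⟨⟨by rw [hmass]; simp⟩, ?_, ?_⟩
    · rw [hmarg _ measurable_fst hq'.map_fst, hp.1.map_fst]
    · rw [hmarg _ measurable_snd hq'.map_snd, hp.1.map_snd]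
  have hcost (q : Measure (X × X)) : cost (r + M⁻¹ • q) = cost r + M⁻¹ * cost q := by
    simp [cost, lintegral_add_measure, lintegral_smul_measure]
  have h1 : cost p ≤ cost (r + M⁻¹ • q') := hp.2 ▸ W2sq_le_cost hplan
  rw [← hsum, hcost, hcost] at h1
  have hrfin : cost r ≠ ∞ := by
    rw [← hsum, hcost] at hfin
    exact (le_self_add.trans_lt hfin).ne
  exact (ENNReal.mul_le_mul_iff_right hMi0 hMi).1 ((ENNReal.add_le_add_iff_left hrfin).1 h1)

/-- The difference of the two sides is a multiple of `((1 - s) a - s b)²`. Equality holds when `a :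
b = s : (1 - s)`, so nothing is lost at a point that divides a geodesic in this ratio. -/
lemma ofReal_add_sq_le {a b s : ℝ} (ha : 0 ≤ a) (hb : 0 ≤ b) (hs : 0 < s) (hs1 : s < 1) :
    (ENNReal.ofReal a + ENNReal.ofReal b) ^ 2
      ≤ ENNReal.ofReal s⁻¹ * ENNReal.ofReal a ^ 2
        + ENNReal.ofReal (1 - s)⁻¹ * ENNReal.ofReal b ^ 2 := by
  have h1 : 0 < 1 - s := by linarith
  rw [← ENNReal.ofReal_add ha hb, ← ENNReal.ofReal_pow (by positivity),
    ← ENNReal.ofReal_pow ha, ← ENNReal.ofReal_pow hb, ← ENNReal.ofReal_mul (by positivity),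
    ← ENNReal.ofReal_mul (by positivity), ← ENNReal.ofReal_add (by positivity) (by positivity)]
  apply ENNReal.ofReal_le_ofReal
  have : s⁻¹ * a ^ 2 + (1 - s)⁻¹ * b ^ 2 - (a + b) ^ 2
      = ((1 - s) * a - s * b) ^ 2 * (s⁻¹ * (1 - s)⁻¹) := by
    field_simp
    ring
  have : 0 ≤ ((1 - s) * a - s * b) ^ 2 * (s⁻¹ * (1 - s)⁻¹) := by positivity
  linarith

/-- If `g` lies on geodesics from `f` to `h` at a fixed ratio and the joint law of `f` and `h` is
an optimal plan, then so is the joint law of `g` and `h`. -/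
lemma isOptimalPlan_of_intermediate [CompleteSpace X] {Ω : Type*} [MeasurableSpace Ω]
    {P : Measure Ω} [IsProbabilityMeasure P] {f g h : Ω → X} (hf : Measurable f)
    (hg : Measurable g) (hh : Measurable h) {s : ℝ} (hs : 0 < s) (hs1 : s < 1)
    (hopt : IsOptimalPlan (P.map fun ω => (f ω, h ω)) (P.map f) (P.map h))
    (hfin : cost (P.map fun ω => (f ω, h ω)) < ∞)
    (hfg : ∀ ω, dist (f ω) (g ω) = s * dist (f ω) (h ω))
    (hgh : ∀ ω, dist (g ω) (h ω) = (1 - s) * dist (f ω) (h ω)) :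
    IsOptimalPlan (P.map fun ω => (g ω, h ω)) (P.map g) (P.map h) := by
  have hs' : 0 < 1 - s := by linarith
  obtain ⟨ω₀⟩ := P.nonempty_of_neZero
  have : Nonempty X := ⟨f ω₀⟩
  have hprob {Y : Type _} [MeasurableSpace Y] {k : Ω → Y} (hk : Measurable k) :
      IsProbabilityMeasure (P.map k) := Measure.isProbabilityMeasure_map hk.aemeasurable
  refine isOptimalPlan_of_forall_le ⟨hprob (hg.prodMk hh), ?_, ?_⟩ fun q hq => ?_
  · rw [Measure.map_map measurable_fst (hg.prodMk hh)]; rfl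
  · rw [Measure.map_map measurable_snd (hg.prodMk hh)]; rfl
  have hqp := hq.isProbabilityMeasure
  set κ := q.condKernel with hκ
  have hdis : (P.map g) ⊗ₘ κ = q := by
    rw [← hq.map_fst]; exact q.disintegrate κ
  -- Gluing along `g`: keep `ω` and draw a new endpoint from the conditional law of `q` given `g ω`.
  -- Together with `f ω` this gives a competitor for the optimal plan of `f` and `h`.
  set Q : Measure (Ω × X) := P ⊗ₘ (κ.comap g hg) with hQ
  have hQm : Q.map (fun p => (g p.1, p.2)) = q := by
    have hmeas : Measurable fun p : Ω × X => (g p.1, p.2) :=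
      (hg.comp measurable_fst).prodMk measurable_snd
    rw [← hdis]
    ext A hA
    rw [Measure.map_apply hmeas hA, hQ, Measure.compProd_apply (hmeas hA),
      Measure.compProd_apply hA, lintegral_map (Kernel.measurable_kernel_prodMk_left hA) hg]
    rfl
  have hfm : Measurable fun p : Ω × X => (f p.1, p.2) :=
    (hf.comp measurable_fst).prodMk measurable_snd
  have hgm : Measurable fun p : Ω × X => (g p.1, p.2) :=
    (hg.comp measurable_fst).prodMk measurable_snd
  have hQ1 : Q.map Prod.fst = P := Measure.fst_compProd _ _
  have hplan : IsPlan (Q.map fun p => (f p.1, p.2)) (P.map f) (P.map h) := by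
    refine ⟨Measure.isProbabilityMeasure_map hfm.aemeasurable, ?_, ?_⟩
    · rw [Measure.map_map measurable_fst hfm]
      change Q.map (f ∘ Prod.fst) = _
      rw [← Measure.map_map hf measurable_fst, hQ1]
    · rw [Measure.map_map measurable_snd hfm, ← hq.map_snd, ← hQm,
        Measure.map_map measurable_snd hgm]
      rfl
  have hD := measurable_edist_sq (X := X)
  set c := cost (P.map fun ω => (f ω, h ω)) with hc
  have hc' : c = ∫⁻ ω, edist (f ω) (h ω) ^ 2 ∂P := by
    rw [hc, cost, lintegral_map hD (hf.prodMk hh)]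
  have h1 : c ≤ cost (Q.map fun p => (f p.1, p.2)) := hopt.2.trans_le (W2sq_le_cost hplan)
  have h2 : cost (Q.map fun p => (f p.1, p.2)) ≤
      ENNReal.ofReal s * c + ENNReal.ofReal (1 - s)⁻¹ * cost q := by
    have e1 : ∫⁻ p, edist (f p.1) (g p.1) ^ 2 ∂Q = ENNReal.ofReal s ^ 2 * c := by
      rw [hc', ← lintegral_const_mul' _ _ (by finiteness), ← hQ1,
        lintegral_map (((hf.edist hh).pow_const 2).const_mul _) measurable_fst]
      refine lintegral_congr fun p => ?_
      rw [edist_dist, hfg, ENNReal.ofReal_mul hs.le, mul_pow, ← edist_dist]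
    have e2 : ∫⁻ p, edist (g p.1) p.2 ^ 2 ∂Q = cost q := by
      rw [cost, ← hQm, lintegral_map hD hgm]
    calc cost (Q.map fun p => (f p.1, p.2)) = ∫⁻ p, edist (f p.1) p.2 ^ 2 ∂Q := by
          rw [cost, lintegral_map hD hfm]
      _ ≤ ∫⁻ p, (ENNReal.ofReal s⁻¹ * edist (f p.1) (g p.1) ^ 2
            + ENNReal.ofReal (1 - s)⁻¹ * edist (g p.1) p.2 ^ 2) ∂Q := by
          refine lintegral_mono fun p => ?_
          have ht : edist (f p.1) p.2 ≤ edist (f p.1) (g p.1) + edist (g p.1) p.2 :=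
            edist_triangle _ _ _
          refine (pow_le_pow_left' ht 2).trans ?_
          simp only [edist_dist]
          exact ofReal_add_sq_le dist_nonneg dist_nonneg hs hs1
      _ = ENNReal.ofReal s⁻¹ * (ENNReal.ofReal s ^ 2 * c)
            + ENNReal.ofReal (1 - s)⁻¹ * cost q := by
          rw [lintegral_add_left, lintegral_const_mul' _ _ (by finiteness),
            lintegral_const_mul' _ _ (by finiteness), e1, e2]
          exact (((hf.comp measurable_fst).edist (hg.comp measurable_fst)).pow_const 2).const_mul _
      _ = _ := by
          rw [← mul_assoc, ← ENNReal.ofReal_pow hs.le, ← ENNReal.ofReal_mul (by positivity)]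
          congr 3
          field_simp
  have h3 : cost (P.map fun ω => (g ω, h ω)) = ENNReal.ofReal (1 - s) ^ 2 * c := by
    rw [hc', ← lintegral_const_mul' _ _ (by finiteness), cost,
      lintegral_map hD (hg.prodMk hh)]
    refine lintegral_congr fun p => ?_
    rw [edist_dist, hgh, ENNReal.ofReal_mul hs'.le, mul_pow, ← edist_dist]
  rw [h3]
  -- This reads `c ≤ s c + (1 - s)⁻¹ cost q`, which rearranges to `(1 - s)² c ≤ cost q`; the left
  -- side is the cost of the plan of `g` and `h`.
  have h4 := h1.trans h2
  rcases eq_or_ne (cost q) ∞ with hqt | hqt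
  · rw [hqt]; exact le_top
  lift c to NNReal using hfin.ne with c'
  generalize cost q = d at *
  lift d to NNReal using hqt
  rw [← ENNReal.ofReal_pow hs'.le, ← ENNReal.ofReal_coe_nnreal, ← ENNReal.ofReal_coe_nnreal,
    ← ENNReal.ofReal_mul (by positivity)]
  rw [← ENNReal.ofReal_coe_nnreal, ← ENNReal.ofReal_coe_nnreal, ← ENNReal.ofReal_mul hs.le,
    ← ENNReal.ofReal_mul (by positivity), ← ENNReal.ofReal_add (by positivity) (by positivity),
    ENNReal.ofReal_le_ofReal_iff (by positivity)] at h4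
  apply ENNReal.ofReal_le_ofReal
  have h5 : (1 - s) * (c' : ℝ) ≤ (1 - s)⁻¹ * d := by linarith
  rw [inv_mul_eq_div, le_div_iff₀ hs'] at h5
  nlinarith

end Plans

/-! ### Restricting geodesics and dynamical plans to time intervals -/

section Subsegments

variable {X : Type*} [MetricSpace X]

/-- The point that divides `[a, b]` in the ratio `t : 1 - t`. -/
def interp (a b t : I) : I :=
  ⟨(1 - t) * a + t * b, by
    have := t.2.1; have := t.2.2; have := a.2.1; have := a.2.2; have := b.2.1; have := b.2.2
    constructor <;> nlinarith⟩

lemma coe_interp (a b t : I) : (interp a b t : ℝ) = (1 - t) * a + t * b := rfl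

lemma interp_zero (a b : I) : interp a b 0 = a := Subtype.ext (by simp [coe_interp])

lemma interp_one (a b : I) : interp a b 1 = b := Subtype.ext (by simp [coe_interp])

lemma continuous_interp (a b : I) : Continuous (interp a b) := by
  unfold interp; fun_prop

/-- The geodesic `γ` between the times `a` and `b`, parametrized by the unit interval. -/
def Geo.subsegment (a b : I) (γ : Geo X) : Geo X :=
  ⟨γ.1.comp ⟨interp a b, continuous_interp a b⟩, fun s t => by
    simp only [ContinuousMap.comp_apply, ContinuousMap.coe_mk, interp_zero, interp_one]
    rw [γ.2, γ.2 a b, ← mul_assoc, ← abs_mul, coe_interp, coe_interp,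
      show (1 - (s : ℝ)) * a + s * b - ((1 - t) * a + t * b) = -((s - t) * (a - b)) by ring,
      abs_neg]⟩

lemma Geo.eval_subsegment (a b t : I) (γ : Geo X) :
    Geo.eval t (Geo.subsegment a b γ) = Geo.eval (interp a b t) γ := rfl

lemma Geo.measurable_subsegment (a b : I) : Measurable (Geo.subsegment (X := X) a b) :=
  (((ContinuousMap.continuous_precomp _).comp continuous_subtype_val).subtype_mk _).measurable

variable [MeasurableSpace X]

lemma map_eval_map_subsegment [BorelSpace X] (Q : Measure (Geo X)) (a b t : I) :
    (Q.map (Geo.subsegment a b)).map (Geo.eval t) = Q.map (Geo.eval (interp a b t)) := by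
  rw [Measure.map_map (Geo.measurable_eval t) (Geo.measurable_subsegment a b)]
  rfl

variable [BorelSpace X] [SecondCountableTopology X]

lemma Geo.measurable_eval_prod (a b : I) :
    Measurable fun γ : Geo X => (Geo.eval a γ, Geo.eval b γ) :=
  (Geo.measurable_eval a).prodMk (Geo.measurable_eval b)

lemma mem_optGeo_iff {μ₀ μ₁ : Measure X} {Q : Measure (Geo X)} :
    Q ∈ OptGeo μ₀ μ₁ ↔ IsProbabilityMeasure Q ∧ Q.map (Geo.eval 0) = μ₀ ∧
      Q.map (Geo.eval 1) = μ₁ ∧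
      IsOptimalPlan (Q.map fun γ => (Geo.eval 0 γ, Geo.eval 1 γ)) μ₀ μ₁ := by
  refine ⟨fun h => ⟨h.1, ?_, ?_, h.2⟩, fun h => ⟨h.1, h.2.2.2⟩⟩
  · rw [← h.2.1.map_fst, Measure.map_map measurable_fst (Geo.measurable_eval_prod 0 1)]; rfl
  · rw [← h.2.1.map_snd, Measure.map_map measurable_snd (Geo.measurable_eval_prod 0 1)]; rfl

lemma map_subsegment_mem_optGeo {Q : Measure (Geo X)} [IsProbabilityMeasure Q] {a b : I}
    (h : IsOptimalPlan (Q.map fun γ => (Geo.eval a γ, Geo.eval b γ))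
      (Q.map (Geo.eval a)) (Q.map (Geo.eval b))) :
    Q.map (Geo.subsegment a b) ∈ OptGeo (Q.map (Geo.eval a)) (Q.map (Geo.eval b)) := by
  refine ⟨Measure.isProbabilityMeasure_map (Geo.measurable_subsegment a b).aemeasurable, ?_⟩
  rw [Measure.map_map (Geo.measurable_eval_prod 0 1) (Geo.measurable_subsegment a b)]
  simpa only [Function.comp_def, Geo.eval_subsegment, interp_zero, interp_one] using h

variable [CompleteSpace X]

lemma isOptimalPlan_eval_one {Q : Measure (Geo X)} [IsProbabilityMeasure Q]
    (h : IsOptimalPlan (Q.map fun γ => (Geo.eval 0 γ, Geo.eval 1 γ))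
      (Q.map (Geo.eval 0)) (Q.map (Geo.eval 1)))
    (hfin : cost (Q.map fun γ => (Geo.eval 0 γ, Geo.eval 1 γ)) < ∞) {s : I}
    (hs : s ∈ Ioo (0 : I) 1) :
    IsOptimalPlan (Q.map fun γ => (Geo.eval s γ, Geo.eval 1 γ))
      (Q.map (Geo.eval s)) (Q.map (Geo.eval 1)) := by
  have h0 : (0 : ℝ) < s := hs.1
  have h1 : (s : ℝ) < 1 := hs.2
  refine isOptimalPlan_of_intermediate (Geo.measurable_eval 0) (Geo.measurable_eval s)
    (Geo.measurable_eval 1) h0 h1 h hfin (fun γ => ?_) (fun γ => ?_)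
  · refine (γ.2 0 s).trans ?_
    simp only [Icc.coe_zero, zero_sub, abs_neg, abs_of_pos h0]; rfl
  · refine (γ.2 s 1).trans ?_
    simp only [Icc.coe_one, abs_sub_comm (s : ℝ), abs_of_pos (sub_pos.2 h1)]; rfl

/-- Time reversal: swap the plan and use the intermediate point at ratio `1 - s` from the endpoint
at time `1`. -/
lemma isOptimalPlan_zero_eval {Q : Measure (Geo X)} [IsProbabilityMeasure Q]
    (h : IsOptimalPlan (Q.map fun γ => (Geo.eval 0 γ, Geo.eval 1 γ))
      (Q.map (Geo.eval 0)) (Q.map (Geo.eval 1)))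
    (hfin : cost (Q.map fun γ => (Geo.eval 0 γ, Geo.eval 1 γ)) < ∞) {s : I}
    (hs : s ∈ Ioo (0 : I) 1) :
    IsOptimalPlan (Q.map fun γ => (Geo.eval 0 γ, Geo.eval s γ))
      (Q.map (Geo.eval 0)) (Q.map (Geo.eval s)) := by
  have h0 : (0 : ℝ) < s := hs.1
  have h1 : (s : ℝ) < 1 := hs.2
  have hsw (a b : I) : (Q.map fun γ => (Geo.eval a γ, Geo.eval b γ)).map Prod.swap =
      Q.map fun γ => (Geo.eval b γ, Geo.eval a γ) := by
    rw [Measure.map_map measurable_swap (Geo.measurable_eval_prod a b)]; rfl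
  rw [← hsw]
  apply IsOptimalPlan.swap
  refine isOptimalPlan_of_intermediate (Geo.measurable_eval 1) (Geo.measurable_eval s)
    (Geo.measurable_eval 0) (s := 1 - s) (by linarith) (by linarith) ?_ ?_
    (fun γ => ?_) (fun γ => ?_)
  · rw [← hsw]; exact h.swap
  · rwa [← hsw, cost_map_swap]
  · refine (γ.2 1 s).trans ?_
    simp only [Icc.coe_one, abs_of_pos (sub_pos.2 h1), dist_comm (γ 0)]; rfl
  · refine (γ.2 s 0).trans ?_
    simp only [Icc.coe_zero, sub_zero, abs_of_pos h0, sub_sub_cancel, dist_comm (γ 0)]; rfl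

end Subsegments

/-! ### Entropy bounds and the entropy of a mixture -/

section Entropy

variable {X : Type*} [MetricSpace X] [MeasurableSpace X] {m μ : Measure X}

lemma sub_one_le_mul_log {x : ℝ} (hx : 0 ≤ x) : x - 1 ≤ x * Real.log x := by
  rcases hx.eq_or_lt with rfl | hx
  · simp
  · have := mul_le_mul_of_nonneg_left (Real.one_sub_inv_le_log_of_pos hx) hx.le
    rwa [mul_sub, mul_one, mul_inv_cancel₀ hx.ne'] at this

lemma measurable_entDensity : Measurable (entDensity m μ) := by
  have := (Measure.measurable_rnDeriv μ m).ennreal_toReal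
  exact this.mul this.log

lemma rnDeriv_ae_eq_zero_of_null {A : Set X} (hA : MeasurableSet A) (h : μ A = 0) :
    ∀ᵐ x ∂m, x ∈ A → μ.rnDeriv m x = 0 := by
  have h1 : ∫⁻ x in A, μ.rnDeriv m x ∂m = 0 :=
    le_antisymm ((Measure.setLIntegral_rnDeriv_le A).trans_eq h) (zero_le)
  rw [lintegral_eq_zero_iff (Measure.measurable_rnDeriv μ m)] at h1
  exact (ae_restrict_iff' hA).1 h1

/-- Since `ρ log ρ ≥ ρ - 1 ≥ -1` and `ρ` vanishes off `C`, the negative part is controlled by the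
measure of `C`. This makes finite entropies real integrals, bounded below by `-m C`. -/
lemma neg_entDensity_ae_le {C : Set X} (hC : MeasurableSet C) (h : μ Cᶜ = 0) :
    ∀ᵐ x ∂m, -entDensity m μ x ≤ C.indicator (fun _ => 1) x := by
  filter_upwards [rnDeriv_ae_eq_zero_of_null hC.compl h] with x hx
  by_cases hxC : x ∈ C
  · have := sub_one_le_mul_log (ENNReal.toReal_nonneg (a := μ.rnDeriv m x))
    have := ENNReal.toReal_nonneg (a := μ.rnDeriv m x)
    simp only [hxC, indicator_of_mem, entDensity]
    linarith
  · simp [entDensity, hx hxC, hxC]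

lemma Ent_ne_top_iff : Ent m μ ≠ ⊤ ↔
    μ ≪ m ∧ ∫⁻ x, ENNReal.ofReal (entDensity m μ x) ∂m < ∞ := by
  unfold Ent
  split_ifs with h
  · refine iff_of_true ?_ h
    rw [sub_eq_add_neg]
    refine (EReal.add_lt_top ?_ ?_).ne
    · simpa using h.2.ne
    · simp
  · simp only [ne_eq, not_true_eq_false, h]

lemma integrable_entDensity {C : Set X} (hC : MeasurableSet C) (h : μ Cᶜ = 0) (hmC : m C ≠ ∞)
    (hE : Ent m μ ≠ ⊤) : Integrable (entDensity m μ) m := by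
  have h1 := (Ent_ne_top_iff.1 hE).2
  have hle : ∀ᵐ x ∂m, ‖entDensity m μ x‖ₑ ≤
      ENNReal.ofReal (entDensity m μ x) + C.indicator (fun _ => 1) x := by
    filter_upwards [neg_entDensity_ae_le hC h] with x hx
    rw [← ofReal_norm, Real.norm_eq_abs]
    rcases le_total 0 (entDensity m μ x) with h0 | h0
    · rw [abs_of_nonneg h0]; exact le_self_add
    · rw [abs_of_nonpos h0]
      refine (ENNReal.ofReal_le_ofReal hx).trans (le_add_left ?_)
      by_cases hxC : x ∈ C <;> simp [hxC]
  refine ⟨measurable_entDensity.aestronglyMeasurable, (lintegral_mono_ae hle).trans_lt ?_⟩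
  rw [lintegral_add_left measurable_entDensity.ennreal_ofReal, lintegral_indicator hC]
  simp only [setLIntegral_const, one_mul]
  finiteness

lemma Ent_eq_integral {C : Set X} (hC : MeasurableSet C) (h : μ Cᶜ = 0) (hmC : m C ≠ ∞)
    (hE : Ent m μ ≠ ⊤) : Ent m μ = ((∫ x, entDensity m μ x ∂m : ℝ) : EReal) := by
  have hint := integrable_entDensity hC h hmC hE
  have h1 := Ent_ne_top_iff.1 hE
  have h2 : ∫⁻ x, ENNReal.ofReal (-entDensity m μ x) ∂m ≠ ∞ := hint.neg.lintegral_lt_top.ne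
  rw [integral_eq_lintegral_pos_part_sub_lintegral_neg_part hint, Ent, if_pos h1]
  lift ∫⁻ x, ENNReal.ofReal (-entDensity m μ x) ∂m to NNReal using h2 with b
  have h3 := h1.2.ne
  lift ∫⁻ x, ENNReal.ofReal (entDensity m μ x) ∂m to NNReal using h3 with a
  simp
  rfl

lemma neg_measure_le_integral_entDensity {C : Set X} (hC : MeasurableSet C) (h : μ Cᶜ = 0)
    (hmC : m C ≠ ∞) (hE : Ent m μ ≠ ⊤) : -m.real C ≤ ∫ x, entDensity m μ x ∂m := by
  have h1 : ∫ x, -entDensity m μ x ∂m ≤ ∫ x, C.indicator (fun _ => (1 : ℝ)) x ∂m :=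
    integral_mono_ae (integrable_entDensity hC h hmC hE).neg
      ((integrable_indicator_iff hC).2 (integrableOn_const hmC)) (neg_entDensity_ae_le hC h)
  rw [integral_neg, integral_indicator hC, setIntegral_const, smul_eq_mul, mul_one] at h1
  linarith

variable [SigmaFinite m]

lemma rnDeriv_le_of_le_smul [SigmaFinite μ] {R : ℝ≥0∞} (h : μ ≤ R • m) :
    ∀ᵐ x ∂m, μ.rnDeriv m x ≤ R := by
  refine ae_le_of_forall_setLIntegral_le_of_sigmaFinite (Measure.measurable_rnDeriv μ m)
    fun s _ _ => ?_
  rw [setLIntegral_const]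
  exact (Measure.setLIntegral_rnDeriv_le s).trans (h s)

lemma entDensity_ae_le_of_le_smul [SigmaFinite μ] {R : ℝ} (hR : 0 < R)
    (h : μ ≤ ENNReal.ofReal R • m) :
    ∀ᵐ x ∂m, entDensity m μ x ≤ (μ.rnDeriv m x).toReal * Real.log R := by
  filter_upwards [rnDeriv_le_of_le_smul h] with x hx
  unfold entDensity
  rcases (ENNReal.toReal_nonneg (a := μ.rnDeriv m x)).eq_or_lt with h0 | h0
  · simp [← h0]
  · gcongr
    exact ENNReal.toReal_le_of_le_ofReal hR.le hx

lemma Ent_ne_top_of_le_smul [IsFiniteMeasure μ] {R : ℝ} (hR : 0 < R)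
    (h : μ ≤ ENNReal.ofReal R • m) : Ent m μ ≠ ⊤ := by
  refine Ent_ne_top_iff.2 ⟨Measure.absolutelyContinuous_of_le_smul h, ?_⟩
  have h1 : Integrable (fun x => (μ.rnDeriv m x).toReal * Real.log R) m :=
    Measure.integrable_toReal_rnDeriv.mul_const _
  refine (lintegral_mono_ae ?_).trans_lt h1.lintegral_lt_top
  filter_upwards [entDensity_ae_le_of_le_smul hR h] with x hx
  exact ENNReal.ofReal_le_ofReal hx

/-- Only the logarithm of the density bound enters; the chaining over many short time steps depends
on this. -/
lemma integral_entDensity_le_log [IsProbabilityMeasure μ] {R : ℝ} (hR : 0 < R)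
    (h : μ ≤ ENNReal.ofReal R • m) (hint : Integrable (entDensity m μ) m) :
    ∫ x, entDensity m μ x ∂m ≤ Real.log R := by
  have h1 := integral_mono_ae hint (Measure.integrable_toReal_rnDeriv.mul_const _)
    (entDensity_ae_le_of_le_smul hR h)
  rwa [integral_mul_const, Measure.integral_toReal_rnDeriv
    (Measure.absolutelyContinuous_of_le_smul h), probReal_univ, one_mul] at h1

/-- Mixing two mutually singular probability measures in equal parts lowers the entropy
by `log 2`. -/
lemma integral_entDensity_mix {μ ν : Measure X} [IsProbabilityMeasure μ]
    [IsProbabilityMeasure ν] (hμ : μ ≪ m) (hν : ν ≪ m) {A : Set X} (hA : MeasurableSet A)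
    (hμA : μ Aᶜ = 0) (hνA : ν A = 0) (hμi : Integrable (entDensity m μ) m)
    (hνi : Integrable (entDensity m ν) m) :
    ∫ x, entDensity m ((2⁻¹ : ℝ≥0∞) • (μ + ν)) x ∂m =
      (∫ x, entDensity m μ x ∂m + ∫ x, entDensity m ν x ∂m) / 2 - Real.log 2 := by
  have hpt : ∀ᵐ x ∂m, entDensity m ((2⁻¹ : ℝ≥0∞) • (μ + ν)) x =
      (entDensity m μ x + entDensity m ν x) / 2 -
        ((μ.rnDeriv m x).toReal + (ν.rnDeriv m x).toReal) / 2 * Real.log 2 := by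
    filter_upwards [Measure.rnDeriv_smul_left_of_ne_top (μ + ν) m (r := 2⁻¹) (by simp),
      Measure.rnDeriv_add μ ν m, rnDeriv_ae_eq_zero_of_null (m := m) hA hνA,
      rnDeriv_ae_eq_zero_of_null (m := m) hA.compl hμA, μ.rnDeriv_lt_top m,
      ν.rnDeriv_lt_top m] with x h1 h2 h3 h4 h5 h6
    -- Almost everywhere at most one of the two densities is nonzero, so the mixture has density `r
    -- / 2` with `r` the other one.
    have key (r : ℝ) : 2⁻¹ * r * Real.log (2⁻¹ * r) =
        r * Real.log r / 2 - r / 2 * Real.log 2 := by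
      rcases eq_or_ne r 0 with rfl | hr
      · simp
      · rw [Real.log_mul (by norm_num) hr, Real.log_inv]; ring
    simp only [entDensity, h1, Pi.smul_apply, h2, Pi.add_apply, smul_eq_mul, ENNReal.toReal_mul,
      ENNReal.toReal_add h5.ne h6.ne, ENNReal.toReal_inv, ENNReal.toReal_ofNat]
    by_cases hx : x ∈ A
    · simp [h3 hx, key]
    · simp [h4 hx, key]
  have i1 : Integrable (fun x => (μ.rnDeriv m x).toReal) m := Measure.integrable_toReal_rnDeriv
  have i2 : Integrable (fun x => (ν.rnDeriv m x).toReal) m := Measure.integrable_toReal_rnDeriv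
  rw [integral_congr_ae hpt, integral_sub (f := fun x => (entDensity m μ x + entDensity m ν x) / 2)
    (g := fun x => ((μ.rnDeriv m x).toReal + (ν.rnDeriv m x).toReal) / 2 * Real.log 2)
    ((hμi.add hνi).div_const 2) (((i1.add i2).div_const 2).mul_const _),
    integral_div, integral_mul_const, integral_div,
    integral_add hμi hνi, integral_add i1 i2, Measure.integral_toReal_rnDeriv hμ,
    Measure.integral_toReal_rnDeriv hν]
  simp

end Entropy

/-! ### Entropy along tame plans and the cost of branching -/

section Tame

variable {X : Type*} [MetricSpace X] [MeasurableSpace X]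

/-- `Q` is an optimal dynamical plan that is concentrated on geodesics inside the set `C` of finite
measure and of diameter at most `D`, and whose endpoint marginals have densities at most `R`. -/
structure IsTame (m : Measure X) (C : Set X) (D R : ℝ) (Q : Measure (Geo X)) : Prop where
  isProbabilityMeasure : IsProbabilityMeasure Q
  measurableSet : MeasurableSet C
  measure_ne_top : m C ≠ ∞
  dist_le : ∀ x ∈ C, ∀ y ∈ C, dist x y ≤ D
  bound_pos : 0 < R
  ae_mem : ∀ᵐ γ ∂Q, ∀ t, Geo.eval t γ ∈ C
  optimal : IsOptimalPlan (Q.map fun γ => (Geo.eval 0 γ, Geo.eval 1 γ))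
    (Q.map (Geo.eval 0)) (Q.map (Geo.eval 1))
  map_zero_le : Q.map (Geo.eval 0) ≤ ENNReal.ofReal R • m
  map_one_le : Q.map (Geo.eval 1) ≤ ENNReal.ofReal R • m

/-- The entropy of the marginal of `Q` at time `t`. -/
noncomputable def entAt (m : Measure X) (Q : Measure (Geo X)) (t : I) : ℝ :=
  ∫ x, entDensity m (Q.map (Geo.eval t)) x ∂m

variable [BorelSpace X] [SecondCountableTopology X]

instance isProbabilityMeasure_map_eval {Q : Measure (Geo X)} [IsProbabilityMeasure Q] (t : I) :
    IsProbabilityMeasure (Q.map (Geo.eval t)) :=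
  Measure.isProbabilityMeasure_map (Geo.measurable_eval t).aemeasurable

lemma isPlan_map_eval {Q : Measure (Geo X)} [IsProbabilityMeasure Q] (a b : I) :
    IsPlan (Q.map fun γ => (Geo.eval a γ, Geo.eval b γ))
      (Q.map (Geo.eval a)) (Q.map (Geo.eval b)) where
  isProbabilityMeasure :=
    Measure.isProbabilityMeasure_map (Geo.measurable_eval_prod a b).aemeasurable
  map_fst := by rw [Measure.map_map measurable_fst (Geo.measurable_eval_prod a b)]; rfl
  map_snd := by rw [Measure.map_map measurable_snd (Geo.measurable_eval_prod a b)]; rfl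

lemma optimal_of_le_smul {P Q : Measure (Geo X)} [IsProbabilityMeasure Q] {μ ν : Measure X}
    (hP : IsOptimalPlan (P.map fun γ => (Geo.eval 0 γ, Geo.eval 1 γ)) μ ν)
    (hfin : cost (P.map fun γ => (Geo.eval 0 γ, Geo.eval 1 γ)) < ∞) {M : ℝ≥0∞} (hM0 : M ≠ 0)
    (hM : M ≠ ∞) (hQ : Q ≤ M • P) :
    IsOptimalPlan (Q.map fun γ => (Geo.eval 0 γ, Geo.eval 1 γ))
      (Q.map (Geo.eval 0)) (Q.map (Geo.eval 1)) := by
  have hplan := isPlan_map_eval (Q := Q) 0 1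
  have := hplan.isProbabilityMeasure
  have h := hP.of_le_smul hfin hM0 hM (q := Q.map fun γ => (Geo.eval 0 γ, Geo.eval 1 γ)) (by
    rw [← Measure.map_smul]
    exact Measure.map_mono hQ (Geo.measurable_eval_prod 0 1))
  rwa [hplan.map_fst, hplan.map_snd] at h

namespace IsTame

variable {m : Measure X} {C : Set X} {D R K : ℝ} {Q P : Measure (Geo X)}

lemma cost_le (h : IsTame m C D R Q) (a b : I) :
    cost (Q.map fun γ => (Geo.eval a γ, Geo.eval b γ)) ≤ ENNReal.ofReal (D ^ 2) := by
  have := h.isProbabilityMeasure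
  rw [cost, lintegral_map measurable_edist_sq (Geo.measurable_eval_prod a b)]
  calc ∫⁻ γ, edist (Geo.eval a γ) (Geo.eval b γ) ^ 2 ∂Q
      ≤ ∫⁻ _, ENNReal.ofReal (D ^ 2) ∂Q := by
        refine lintegral_mono_ae ?_
        filter_upwards [h.ae_mem] with γ hγ
        rw [edist_dist, ← ENNReal.ofReal_pow dist_nonneg]
        have := h.dist_le _ (hγ a) _ (hγ b)
        gcongr
    _ = _ := by simp

lemma isP2 (h : IsTame m C D R Q) (t : I) : IsP2 (Q.map (Geo.eval t)) := by
  have := h.isProbabilityMeasure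
  obtain ⟨γ₀, hγ₀⟩ := h.ae_mem.exists
  refine ⟨inferInstance, Geo.eval 0 γ₀, ?_⟩
  have hm : Measurable fun x : X => edist x (Geo.eval 0 γ₀) ^ 2 :=
    (measurable_id.edist measurable_const).pow_const 2
  rw [lintegral_map hm (Geo.measurable_eval t)]
  calc ∫⁻ γ, edist (Geo.eval t γ) (Geo.eval 0 γ₀) ^ 2 ∂Q
      ≤ ∫⁻ _, ENNReal.ofReal D ^ 2 ∂Q := by
        refine lintegral_mono_ae ?_
        filter_upwards [h.ae_mem] with γ hγ
        rw [edist_dist]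
        have := h.dist_le _ (hγ t) _ (hγ₀ 0)
        gcongr
    _ < ∞ := by simp

lemma cost_lt_top (h : IsTame m C D R Q) :
    cost (Q.map fun γ => (Geo.eval 0 γ, Geo.eval 1 γ)) < ∞ :=
  (h.cost_le 0 1).trans_lt ENNReal.ofReal_lt_top

lemma W2sq_le (h : IsTame m C D R Q) (a b : I) :
    (W2sq (Q.map (Geo.eval a)) (Q.map (Geo.eval b))).toReal ≤ D ^ 2 := by
  have := h.isProbabilityMeasure
  exact ENNReal.toReal_le_of_le_ofReal (by positivity)
    ((W2sq_le_cost (isPlan_map_eval a b)).trans (h.cost_le a b))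

lemma map_compl (h : IsTame m C D R Q) (t : I) : Q.map (Geo.eval t) Cᶜ = 0 := by
  rw [Measure.map_apply (Geo.measurable_eval t) h.measurableSet.compl]
  exact ae_iff.1 (h.ae_mem.mono fun γ hγ => hγ t)

lemma of_le_smul (h : IsTame m C D R P) [IsProbabilityMeasure Q] {M : ℝ} (hM : 0 < M)
    (hQ : Q ≤ ENNReal.ofReal M • P) : IsTame m C D (M * R) Q where
  isProbabilityMeasure := inferInstance
  measurableSet := h.measurableSet
  measure_ne_top := h.measure_ne_top
  dist_le := h.dist_le
  bound_pos := mul_pos hM h.bound_pos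
  ae_mem := (Measure.absolutelyContinuous_of_le_smul hQ).ae_le h.ae_mem
  optimal := optimal_of_le_smul h.optimal h.cost_lt_top (by simpa using hM) (by simp) hQ
  map_zero_le := by
    refine (Measure.map_mono hQ (Geo.measurable_eval 0)).trans ?_
    rw [Measure.map_smul, ENNReal.ofReal_mul hM.le, mul_smul]
    exact fun B => mul_le_mul_right (h.map_zero_le B) _
  map_one_le := by
    refine (Measure.map_mono hQ (Geo.measurable_eval 1)).trans ?_
    rw [Measure.map_smul, ENNReal.ofReal_mul hM.le, mul_smul]
    exact fun B => mul_le_mul_right (h.map_one_le B) _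

lemma neg_le_entAt (h : IsTame m C D R Q) {t : I} (ht : Ent m (Q.map (Geo.eval t)) ≠ ⊤) :
    -m.real C ≤ entAt m Q t :=
  neg_measure_le_integral_entDensity h.measurableSet (h.map_compl t) h.measure_ne_top ht

/-- The plan restricted to `[a, b]` is itself an optimal dynamical plan, so the strong condition
applies to it. As `W₂² ≤ D²`, the curvature term is absorbed into `|K| D²` whatever the sign of `K`.
-/
lemma ent_interp_le (hCD : IsStrongCD K m) (h : IsTame m C D R Q) {a b : I}
    (hopt : IsOptimalPlan (Q.map fun γ => (Geo.eval a γ, Geo.eval b γ))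
      (Q.map (Geo.eval a)) (Q.map (Geo.eval b)))
    (ha : Ent m (Q.map (Geo.eval a)) ≠ ⊤) (hb : Ent m (Q.map (Geo.eval b)) ≠ ⊤) (t : I) :
    Ent m (Q.map (Geo.eval (interp a b t))) ≠ ⊤ ∧
      entAt m Q (interp a b t) ≤ (1 - t) * entAt m Q a + t * entAt m Q b
        + |K| * D ^ 2 * (t * (1 - t)) := by
  have := h.isProbabilityMeasure
  have hE := hCD _ _ (h.isP2 a) (h.isP2 b) _ (map_subsegment_mem_optGeo hopt) ha hb t
  have heq {s : I} (hs : Ent m (Q.map (Geo.eval s)) ≠ ⊤) :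
      Ent m (Q.map (Geo.eval s)) = ((entAt m Q s : ℝ) : EReal) :=
    Ent_eq_integral h.measurableSet (h.map_compl s) h.measure_ne_top hs
  rw [map_eval_map_subsegment, heq ha, heq hb, ← EReal.coe_mul, ← EReal.coe_mul,
    ← EReal.coe_add, ← EReal.coe_sub] at hE
  have hne : Ent m (Q.map (Geo.eval (interp a b t))) ≠ ⊤ :=
    (hE.trans_lt (EReal.coe_lt_top _)).ne
  refine ⟨hne, ?_⟩
  rw [heq hne, EReal.coe_le_coe_iff] at hE
  refine hE.trans ?_
  have ht0 : 0 ≤ (t : ℝ) := t.2.1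
  have ht1 : 0 ≤ 1 - (t : ℝ) := sub_nonneg.2 t.2.2
  have hW := h.W2sq_le a b
  set W := (W2sq (Q.map (Geo.eval a)) (Q.map (Geo.eval b))).toReal with hWdef
  have hW0 : 0 ≤ W := ENNReal.toReal_nonneg
  have h1 : -(K / 2 * t * (1 - t) * W) ≤ |K| * W * (t * (1 - t)) := by
    have : 0 ≤ (t : ℝ) * (1 - t) * W := by positivity
    have := neg_abs_le K
    have := abs_nonneg K
    nlinarith
  have h2 : |K| * W * (t * (1 - t)) ≤ |K| * D ^ 2 * (t * (1 - t)) := by gcongr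
  linarith

variable [SigmaFinite m]

lemma ent_zero_ne_top (h : IsTame m C D R Q) : Ent m (Q.map (Geo.eval 0)) ≠ ⊤ := by
  have := h.isProbabilityMeasure
  exact Ent_ne_top_of_le_smul h.bound_pos h.map_zero_le

lemma ent_one_ne_top (h : IsTame m C D R Q) : Ent m (Q.map (Geo.eval 1)) ≠ ⊤ := by
  have := h.isProbabilityMeasure
  exact Ent_ne_top_of_le_smul h.bound_pos h.map_one_le

/-- No density bound is available at interior times; finiteness is inherited from the endpoints by
convexity. -/
lemma ent_ne_top (hCD : IsStrongCD K m) (h : IsTame m C D R Q) (t : I) :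
    Ent m (Q.map (Geo.eval t)) ≠ ⊤ := by
  have h1 := (h.ent_interp_le hCD h.optimal h.ent_zero_ne_top h.ent_one_ne_top t).1
  rwa [show interp 0 1 t = t from Subtype.ext (by simp [coe_interp])] at h1

lemma integrable (hCD : IsStrongCD K m) (h : IsTame m C D R Q) (t : I) :
    Integrable (entDensity m (Q.map (Geo.eval t))) m :=
  integrable_entDensity h.measurableSet (h.map_compl t) h.measure_ne_top (h.ent_ne_top hCD t)

lemma entAt_zero_le (h : IsTame m C D R Q) : entAt m Q 0 ≤ Real.log R := by
  have := h.isProbabilityMeasure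
  exact integral_entDensity_le_log h.bound_pos h.map_zero_le
    (integrable_entDensity h.measurableSet (h.map_compl 0) h.measure_ne_top h.ent_zero_ne_top)

lemma entAt_one_le (h : IsTame m C D R Q) : entAt m Q 1 ≤ Real.log R := by
  have := h.isProbabilityMeasure
  exact integral_entDensity_le_log h.bound_pos h.map_one_le
    (integrable_entDensity h.measurableSet (h.map_compl 1) h.measure_ne_top h.ent_one_ne_top)

variable [CompleteSpace X]

/-- Convexity of the entropy on `[0, s']`. -/
lemma entAt_le_left (hCD : IsStrongCD K m) (h : IsTame m C D R Q) {s s' : I} (hs : 0 < s)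
    (hss : s < s') (hs' : s' < 1) :
    (s' : ℝ) * entAt m Q s ≤ s * entAt m Q s' + (s' - s) * (Real.log R + |K| * D ^ 2) := by
  have := h.isProbabilityMeasure
  have hs0 : (0 : ℝ) < s := hs
  have hss0 : (s : ℝ) < s' := hss
  have hs'0 : (0 : ℝ) < s' := hs0.trans hss0
  let t : I := ⟨s / s', by positivity, (div_le_one hs'0).2 hss0.le⟩
  have ht : interp 0 s' t = s := Subtype.ext (by simp [coe_interp, t, hs'0.ne'])
  have h1 := (h.ent_interp_le hCD
    (isOptimalPlan_zero_eval h.optimal h.cost_lt_top ⟨hs.trans hss, hs'⟩)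
    (h.ent_ne_top hCD 0) (h.ent_ne_top hCD s') t).2
  have h0 := h.entAt_zero_le
  rw [ht] at h1
  have htc : (t : ℝ) * s' = s := div_mul_cancel₀ _ hs'0.ne'
  have ht0 : 0 ≤ 1 - (t : ℝ) := sub_nonneg.2 t.2.2
  have ht1 : (t : ℝ) ≤ 1 := t.2.2
  have hK : 0 ≤ |K| * D ^ 2 := by positivity
  have h2 : entAt m Q s ≤ (1 - t) * Real.log R + t * entAt m Q s' + |K| * D ^ 2 * (1 - t) := by
    have e1 : (1 - t) * entAt m Q 0 ≤ (1 - t) * Real.log R := by gcongr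
    have e2 : |K| * D ^ 2 * (t * (1 - t)) ≤ |K| * D ^ 2 * (1 - t) := by
      gcongr; nlinarith
    linarith
  have h3 := mul_le_mul_of_nonneg_left h2 hs'0.le
  rw [← htc]
  linarith

/-- Convexity of the entropy on `[s, 1]`. -/
lemma entAt_le_right (hCD : IsStrongCD K m) (h : IsTame m C D R Q) {s s' : I} (hs : 0 < s)
    (hss : s < s') (hs' : s' < 1) :
    (1 - s : ℝ) * entAt m Q s' ≤
      (1 - s') * entAt m Q s + (s' - s) * (Real.log R + |K| * D ^ 2) := by
  have := h.isProbabilityMeasure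
  have hs0 : (0 : ℝ) < s := hs
  have hss0 : (s : ℝ) < s' := hss
  have hs'1 : (s' : ℝ) < 1 := hs'
  have h1s : 0 < 1 - (s : ℝ) := by linarith
  let t : I := ⟨(s' - s) / (1 - s), div_nonneg (by linarith) h1s.le,
    (div_le_one h1s).2 (by linarith)⟩
  have htc : (t : ℝ) * (1 - s) = s' - s := div_mul_cancel₀ _ h1s.ne'
  have ht : interp s 1 t = s' := Subtype.ext (by
    rw [coe_interp, Icc.coe_one]; linarith)
  have h1 := (h.ent_interp_le hCD
    (isOptimalPlan_eval_one h.optimal h.cost_lt_top ⟨hs, hss.trans hs'⟩)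
    (h.ent_ne_top hCD s) (h.ent_ne_top hCD 1) t).2
  have h0 := h.entAt_one_le
  rw [ht] at h1
  have ht0 : 0 ≤ (t : ℝ) := t.2.1
  have ht1 : (t : ℝ) ≤ 1 := t.2.2
  have h2 : entAt m Q s' ≤ (1 - t) * entAt m Q s + t * Real.log R + |K| * D ^ 2 * t := by
    have e1 : t * entAt m Q 1 ≤ t * Real.log R := by gcongr
    have e2 : |K| * D ^ 2 * (t * (1 - t)) ≤ |K| * D ^ 2 * t := by
      gcongr; nlinarith
    linarith
  have h3 := mul_le_mul_of_nonneg_left h2 h1s.le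
  have h4 : (1 - s' : ℝ) = (1 - t) * (1 - s) := by linarith
  rw [h4, ← htc]
  linarith

/-- Two dynamical plans with the same marginal at time `s` and mutually singular marginals at time
`s'` force a lower bound on `s' - s`. -/
lemma log_two_le_of_branching (hCD : IsStrongCD K m) (h : IsTame m C D R P)
    {Q₁ Q₂ : Measure (Geo X)} [IsProbabilityMeasure Q₁] [IsProbabilityMeasure Q₂] {M : ℝ}
    (hM : 0 < M) (h₁ : Q₁ ≤ ENNReal.ofReal M • P) (h₂ : Q₂ ≤ ENNReal.ofReal M • P) {s s' : I}
    (hs : 0 < s) (hss : s < s') (hs' : s' < 1)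
    (heq : Q₁.map (Geo.eval s) = Q₂.map (Geo.eval s)) {A : Set X} (hA : MeasurableSet A)
    (hA₁ : Q₁.map (Geo.eval s') Aᶜ = 0) (hA₂ : Q₂.map (Geo.eval s') A = 0) :
    s * (1 - s) * Real.log 2 ≤
      (s' - s) * (Real.log (M * R) + |K| * D ^ 2 + m.real C) := by
  have hs0 : (0 : ℝ) < s := hs
  have hss0 : (s : ℝ) < s' := hss
  have hs'1 : (s' : ℝ) < 1 := hs'
  set Q : Measure (Geo X) := (2⁻¹ : ℝ≥0∞) • (Q₁ + Q₂) with hQ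
  have hQp : IsProbabilityMeasure Q := ⟨by simp [hQ, ENNReal.inv_two_add_inv_two]⟩
  have hQle : Q ≤ ENNReal.ofReal M • P := by
    intro B
    have b1 := h₁ B
    have b2 := h₂ B
    simp only [hQ, Measure.smul_apply, Measure.add_apply, smul_eq_mul, mul_add] at b1 b2 ⊢
    refine (add_le_add (mul_le_mul_right b1 _) (mul_le_mul_right b2 _)).trans_eq ?_
    rw [← add_mul, ENNReal.inv_two_add_inv_two, one_mul]
  have t₁ := h.of_le_smul hM h₁
  have t₂ := h.of_le_smul hM h₂
  have t := h.of_le_smul hM hQle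
  have hmap (r : I) : Q.map (Geo.eval r) =
      (2⁻¹ : ℝ≥0∞) • (Q₁.map (Geo.eval r) + Q₂.map (Geo.eval r)) := by
    rw [hQ, Measure.map_smul, Measure.map_add _ _ (Geo.measurable_eval r)]
  have hmaps : Q.map (Geo.eval s) = Q₁.map (Geo.eval s) := by
    rw [hmap, ← heq, ← two_smul ℝ≥0∞, smul_smul, ENNReal.inv_mul_cancel (by simp) (by simp),
      one_smul]
  have e1 : entAt m Q₁ s = entAt m Q s := by rw [entAt, entAt, hmaps]
  have e2 : entAt m Q₂ s = entAt m Q s := by rw [← e1, entAt, entAt, heq]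
  have e3 : entAt m Q s' = (entAt m Q₁ s' + entAt m Q₂ s') / 2 - Real.log 2 := by
    rw [entAt, hmap]
    exact integral_entDensity_mix (Ent_ne_top_iff.1 (t₁.ent_ne_top hCD s')).1
      (Ent_ne_top_iff.1 (t₂.ent_ne_top hCD s')).1 hA hA₁ hA₂ (t₁.integrable hCD s')
      (t₂.integrable hCD s')
  have i1 := t₁.entAt_le_right hCD hs hss hs'
  have i2 := t₂.entAt_le_right hCD hs hss hs'
  have i3 := t.entAt_le_left hCD hs hss hs'
  have i4 := t.neg_le_entAt (t.ent_ne_top hCD s)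
  rw [e1] at i1
  rw [e2] at i2
  rw [e3] at i3
  set e := entAt m Q s
  set B := Real.log (M * R) + |K| * D ^ 2
  -- Adding the mean of `j1` and `j2` to `j3` cancels the entropies at `s'` and leaves `s (1 - s)
  -- log 2 ≤ (s' - s) (B - e)`; then `j4` bounds `-e` by the measure of `C`.
  have j1 := mul_le_mul_of_nonneg_left i1 hs0.le
  have j2 := mul_le_mul_of_nonneg_left i2 hs0.le
  have j3 := mul_le_mul_of_nonneg_left i3 (by linarith : (0 : ℝ) ≤ 1 - s)
  have j4 := mul_le_mul_of_nonneg_left i4 (by linarith : (0 : ℝ) ≤ s' - s)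
  nlinarith

end IsTame

end Tame

/-! ### Reweighting a conditioned measure to a prescribed law -/

section Reweight

variable {Ω X : Type*} [MeasurableSpace Ω] [MeasurableSpace X]

/-- If the conditional probability of `S` given `e` is at least `δ` on `E`, then `P` restricted
to `S` can be reweighted by a bounded function of `e` such that the law of `e` becomes the
normalized restriction to `E` of its law under `P`. -/
lemma exists_reweighted {P : Measure Ω} [IsProbabilityMeasure P] {e : Ω → X} (he : Measurable e)
    {S : Set Ω} (hS : MeasurableSet S) {E : Set X} (hE : MeasurableSet E) {δ : ℝ≥0∞}
    (hδ0 : δ ≠ 0) (hPE : δ ≤ P.map e E)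
    (hδE : ∀ x ∈ E, δ ≤ ((P.restrict S).map e).rnDeriv (P.map e) x) :
    ∃ Q : Measure Ω, IsProbabilityMeasure Q ∧ Q ≤ (δ⁻¹ * δ⁻¹) • P ∧ Q Sᶜ = 0 ∧
      Q.map e = (P.map e E)⁻¹ • (P.map e).restrict E := by
  have hprob : IsProbabilityMeasure (P.map e) := Measure.isProbabilityMeasure_map he.aemeasurable
  set μ := P.map e with hμ
  set ν := (P.restrict S).map e with hν
  have hac : ν ≪ μ := Measure.AbsolutelyContinuous.map
    (Measure.absolutelyContinuous_of_le Measure.restrict_le_self) he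
  set f := ν.rnDeriv μ with hf
  have hfm : Measurable f := Measure.measurable_rnDeriv ν μ
  have hpE0 : μ E ≠ 0 := ((pos_iff_ne_zero.2 hδ0).trans_le hPE).ne'
  have hpE : μ E ≠ ∞ := measure_ne_top _ _
  -- Dividing by the conditional probability `f` turns the law of `e` into the normalized
  -- restriction to `E`. On `E` each of the two factors is at most `δ⁻¹`.
  set g : X → ℝ≥0∞ := E.indicator fun x => (f x)⁻¹ * (μ E)⁻¹ with hg
  have hgm : Measurable g := (hfm.inv.mul_const _).indicator hE
  have hgle : ∀ x, g x ≤ δ⁻¹ * δ⁻¹ := fun x => by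
    refine indicator_apply_le' (fun hx => ?_) (fun _ => zero_le)
    exact mul_le_mul' (ENNReal.inv_le_inv' (hδE x hx)) (ENNReal.inv_le_inv' hPE)
  set Q := (P.restrict S).withDensity (g ∘ e) with hQ
  have hmap : Q.map e = (μ E)⁻¹ • μ.restrict E := by
    have h1 : Q.map e = ν.withDensity g := by
      ext B hB
      rw [Measure.map_apply he hB, withDensity_apply _ (he hB), withDensity_apply _ hB, hν,
        setLIntegral_map hB hgm he]
      rfl
    have h2 : ν = μ.withDensity f := (Measure.withDensity_rnDeriv_eq ν μ hac).symm
    have h3 : f * g =ᵐ[μ] E.indicator fun _ => (μ E)⁻¹ := by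
      filter_upwards [ν.rnDeriv_lt_top μ] with x hx
      by_cases hxE : x ∈ E
      · have hx0 : f x ≠ 0 := ((pos_iff_ne_zero.2 hδ0).trans_le (hδE x hxE)).ne'
        simp only [Pi.mul_apply, hg, hxE, indicator_of_mem]
        rw [← mul_assoc, ENNReal.mul_inv_cancel hx0 hx.ne, one_mul]
      · simp [hg, hxE]
    rw [h1, h2, ← withDensity_mul _ hfm hgm, withDensity_congr_ae h3,
      withDensity_indicator hE, withDensity_const]
  refine ⟨Q, ⟨?_⟩, ?_, ?_, hmap⟩
  · have h1 : Q.map e univ = 1 := by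
      rw [hmap, Measure.smul_apply, Measure.restrict_apply_univ, smul_eq_mul,
        ENNReal.inv_mul_cancel hpE0 hpE]
    rwa [Measure.map_apply he MeasurableSet.univ, preimage_univ] at h1
  · calc Q ≤ (P.restrict S).withDensity fun _ => δ⁻¹ * δ⁻¹ :=
          withDensity_mono (Filter.Eventually.of_forall fun ω => hgle (e ω))
      _ = (δ⁻¹ * δ⁻¹) • P.restrict S := withDensity_const _
      _ ≤ (δ⁻¹ * δ⁻¹) • P := fun B => mul_le_mul_right (Measure.restrict_le_self B) _
  · exact withDensity_absolutelyContinuous _ _ (by rw [Measure.restrict_apply hS.compl]; simp)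

end Reweight

/-! ### The present position determines later positions -/

section Determinism

variable {X : Type*} [MetricSpace X] [MeasurableSpace X] [BorelSpace X]
  [SecondCountableTopology X] [CompleteSpace X] {m : Measure X} [SigmaFinite m] {C : Set X}
  {D R K : ℝ} {P : Measure (Geo X)}

/-- Up to a small error, the position at time `s` determines the position at a slightly later
time `s'`. -/
lemma IsTame.exists_measure_symmDiff_le (hCD : IsStrongCD K m) (h : IsTame m C D R P) {s s' : I}
    (hs : 0 < s) (hss : s < s') (hs' : s' < 1) {δ : ℝ} (hδ : 0 < δ)
    (hlt : (s' - s) * (Real.log (δ⁻¹ * δ⁻¹ * R) + |K| * D ^ 2 + m.real C) <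
      s * (1 - s) * Real.log 2) {A : Set X} (hA : MeasurableSet A) :
    ∃ B, MeasurableSet B ∧
      P ((Geo.eval s' ⁻¹' A) ∆ (Geo.eval s ⁻¹' B)) ≤ 3 * ENNReal.ofReal δ := by
  have := h.isProbabilityMeasure
  set d := ENNReal.ofReal δ with hd
  have hd0 : d ≠ 0 := by simpa [hd] using hδ
  set S : Set (Geo X) := Geo.eval s' ⁻¹' A with hSdef
  have hS : MeasurableSet S := Geo.measurable_eval s' hA
  have he := Geo.measurable_eval (X := X) s
  set e : Geo X → X := Geo.eval s with hedef
  set μ := P.map e with hμ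
  set ν₁ := (P.restrict S).map e with hν₁
  set ν₂ := (P.restrict Sᶜ).map e with hν₂
  have hac (T : Set (Geo X)) : (P.restrict T).map e ≪ μ := Measure.AbsolutelyContinuous.map
    (Measure.absolutelyContinuous_of_le Measure.restrict_le_self) he
  have hsum : ν₁ + ν₂ = μ := by
    rw [hν₁, hν₂, ← Measure.map_add _ _ he, Measure.restrict_add_restrict_compl hS]
  set f₁ := ν₁.rnDeriv μ
  set f₂ := ν₂.rnDeriv μ
  have hf₁ : Measurable f₁ := Measure.measurable_rnDeriv _ _
  have hf₂ : Measurable f₂ := Measure.measurable_rnDeriv _ _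
  have hsmall {T : Set (Geo X)} {B : Set X} (hB : MeasurableSet B)
      (hle : ∀ x ∈ B, ((P.restrict T).map e).rnDeriv μ x ≤ d) :
      (P.restrict T).map e B ≤ d := by
    rw [← Measure.setLIntegral_rnDeriv (hac T)]
    calc ∫⁻ x in B, ((P.restrict T).map e).rnDeriv μ x ∂μ ≤ ∫⁻ _ in B, d ∂μ :=
          setLIntegral_mono measurable_const hle
      _ = d * μ B := by simp
      _ ≤ d := mul_le_of_le_one_right' prob_le_one
  -- `f₁` and `f₂` are the conditional probabilities of `S` and `Sᶜ` given the position at `s`; `E`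
  -- collects the positions that leave the outcome undecided.
  set E : Set X := {x | d ≤ f₁ x} ∩ {x | d ≤ f₂ x} with hE
  have hEm : MeasurableSet E :=
    (measurableSet_le measurable_const hf₁).inter (measurableSet_le measurable_const hf₂)
  rcases le_or_gt d (μ E) with hdE | hdE
  -- The two reweighted plans have the same law at `s`, and `A` separates them at `s'`.
  · exfalso
    obtain ⟨Q₁, hQ₁, hle₁, h0₁, hmap₁⟩ :=
      exists_reweighted he hS hEm hd0 hdE fun x hx => hx.1
    obtain ⟨Q₂, hQ₂, hle₂, h0₂, hmap₂⟩ :=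
      exists_reweighted he hS.compl hEm hd0 hdE fun x hx => hx.2
    have hM : d⁻¹ * d⁻¹ = ENNReal.ofReal (δ⁻¹ * δ⁻¹) := by
      rw [ENNReal.ofReal_mul (by positivity), ENNReal.ofReal_inv_of_pos hδ]
    rw [hM] at hle₁ hle₂
    rw [compl_compl] at h0₂
    have := h.log_two_le_of_branching hCD (by positivity) hle₁ hle₂ hs hss hs'
      (hmap₁.trans hmap₂.symm) hA
      (by rwa [Measure.map_apply (Geo.measurable_eval s') hA.compl])
      (by rwa [Measure.map_apply (Geo.measurable_eval s') hA])
    exact absurd this (not_le.2 hlt)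
  -- Predict `S` where `Sᶜ` is unlikely. A wrong prediction has probability at most `δ` on `B`, and
  -- at most `δ + δ` off `B`: there either `f₁ < δ` or the position lies in `E`.
  · set B : Set X := {x | f₂ x < d} with hBdef
    have hB : MeasurableSet B := measurableSet_lt hf₂ measurable_const
    refine ⟨B, hB, ?_⟩
    have e1 : P (Sᶜ ∩ e ⁻¹' B) = ν₂ B := by
      rw [hν₂, Measure.map_apply he hB, Measure.restrict_apply (he hB), inter_comm]
    have e2 : P (S ∩ (e ⁻¹' B)ᶜ) = ν₁ Bᶜ := by
      rw [hν₁, Measure.map_apply he hB.compl, Measure.restrict_apply (he hB.compl), inter_comm]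
      rfl
    have e3 : ν₂ B ≤ d := hsmall hB fun x hx => (le_of_lt hx : f₂ x ≤ d)
    have e4 : ν₁ Bᶜ ≤ 2 * d := by
      have hsub : Bᶜ ⊆ {x | f₁ x < d} ∪ E := fun x hx => by
        rcases lt_or_ge (f₁ x) d with hlt | hge
        · exact Or.inl hlt
        · exact Or.inr ⟨hge, not_lt.1 (show ¬f₂ x < d from hx)⟩
      have a1 : ν₁ {x | f₁ x < d} ≤ d :=
        hsmall (measurableSet_lt hf₁ measurable_const) fun x hx => (le_of_lt hx : f₁ x ≤ d)
      have a2 : ν₁ E ≤ d := by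
        refine le_trans ?_ hdE.le
        rw [← hsum, Measure.add_apply]; exact le_self_add
      calc ν₁ Bᶜ ≤ ν₁ {x | f₁ x < d} + ν₁ E := (measure_mono hsub).trans (measure_union_le _ _)
        _ ≤ d + d := add_le_add a1 a2
        _ = 2 * d := (two_mul d).symm
    calc P (S ∆ (e ⁻¹' B)) ≤ P (S ∩ (e ⁻¹' B)ᶜ) + P (Sᶜ ∩ e ⁻¹' B) := by
          rw [Set.symmDiff_def, Set.sdiff_eq, Set.sdiff_eq, inter_comm (e ⁻¹' B) Sᶜ]
          exact measure_union_le _ _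
      _ ≤ 2 * d + d := by rw [e1, e2]; exact add_le_add e4 e3
      _ = 3 * d := by ring

lemma tendsto_log_div_atTop (a c : ℝ) :
    Filter.Tendsto (fun N : ℕ => a / N * (Real.log ((N : ℝ) ^ 4 * R) + c)) Filter.atTop
      (nhds 0) := by
  rcases eq_or_ne R 0 with rfl | hR
  · simpa using (tendsto_const_div_atTop_nhds_zero_nat a).mul_const (0 + c)
  have h1 : Filter.Tendsto (fun N : ℕ => Real.log N / N) Filter.atTop (nhds 0) := by
    have := (Real.isLittleO_log_id_atTop.tendsto_div_nhds_zero).comp tendsto_natCast_atTop_atTop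
    exact this
  have h2 := tendsto_const_div_atTop_nhds_zero_nat (a * (Real.log R + c))
  have h3 := (h1.const_mul (4 * a)).add h2
  rw [mul_zero, add_zero] at h3
  refine h3.congr' ?_
  filter_upwards [Filter.eventually_gt_atTop 0] with N hN
  have hN : (N : ℝ) ≠ 0 := by exact_mod_cast hN.ne'
  rw [Real.log_mul (pow_ne_zero _ hN) hR, Real.log_pow]
  push_cast
  ring

/-- Up to an arbitrarily small error, the position at time `a` determines the position at any
later time `b`. -/
lemma IsTame.exists_measure_symmDiff_lt (hCD : IsStrongCD K m) (h : IsTame m C D R P) {a b : I}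
    (ha : 0 < a) (hab : a < b) (hb : b < 1) {A : Set X} (hA : MeasurableSet A) {η : ℝ≥0∞}
    (hη : η ≠ 0) :
    ∃ B, MeasurableSet B ∧ P ((Geo.eval b ⁻¹' A) ∆ (Geo.eval a ⁻¹' B)) < η := by
  have ha0 : (0 : ℝ) < a := ha
  have hab0 : (a : ℝ) < b := hab
  have hb1 : (b : ℝ) < 1 := hb
  -- `a (1 - b)` is a lower bound for `s (1 - s)` at all times `s` in `[a, b]`, so one `N` serves
  -- every step.
  have hpos : 0 < (a : ℝ) * (1 - b) * Real.log 2 :=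
    mul_pos (mul_pos ha0 (by linarith)) (Real.log_pos one_lt_two)
  have hev1 := (tendsto_log_div_atTop (R := R) (b - a : ℝ) (|K| * D ^ 2 + m.real C)).eventually
    (gt_mem_nhds hpos)
  have hlim : Filter.Tendsto (fun N : ℕ => ENNReal.ofReal (3 / N)) Filter.atTop (nhds 0) := by
    simpa using ENNReal.tendsto_ofReal (tendsto_const_div_atTop_nhds_zero_nat 3)
  have hev2 := hlim.eventually (gt_mem_nhds (pos_iff_ne_zero.2 hη))
  obtain ⟨N, ⟨h1, h2⟩, hN⟩ := ((hev1.and hev2).and (Filter.eventually_gt_atTop 0)).exists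
  have hN0 : (0 : ℝ) < N := by exact_mod_cast hN
  -- Backward induction from `b`. With `δ = N⁻²` the errors add up to at most `3 / N`, while `δ⁻² =
  -- N⁴` enters each step only through its logarithm, against a step length `(b - a) / N`.
  have hchain : ∀ k : ℕ, k ≤ N → ∀ s : I, (s : ℝ) = b - (b - a) / N * k →
      ∃ B, MeasurableSet B ∧ P ((Geo.eval b ⁻¹' A) ∆ (Geo.eval s ⁻¹' B)) ≤
        k * (3 * ENNReal.ofReal (1 / (N : ℝ) ^ 2)) := by
    intro k
    induction k with
    | zero =>
      intro _ s hs
      have : s = b := Subtype.ext (by simpa using hs)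
      exact ⟨A, hA, by simp [this]⟩
    | succ k ih =>
      intro hk s hs
      have hkN : (k : ℝ) + 1 ≤ N := by exact_mod_cast hk
      have hstep : (b - a : ℝ) / N * N = b - a := div_mul_cancel₀ _ hN0.ne'
      have hε : 0 < (b - a : ℝ) / N := div_pos (by linarith) hN0
      have hk0 : (0 : ℝ) ≤ k := k.cast_nonneg
      have hr1 : (b - (b - a) / N * k : ℝ) ≤ b := by nlinarith
      have hr0 : (a : ℝ) + (b - a) / N ≤ b - (b - a) / N * k := by nlinarith
      let s' : I := ⟨b - (b - a) / N * k, by linarith, by linarith⟩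
      have hs'c : (s' : ℝ) = b - (b - a) / N * k := rfl
      push_cast at hs
      have hdiff : (s' : ℝ) - s = (b - a) / N := by rw [hs, hs'c]; ring
      have hsa : (a : ℝ) ≤ s := by linarith
      have hss : s < s' := by
        change (s : ℝ) < s'; linarith
      have hs'1 : s' < 1 := by
        change (s' : ℝ) < 1; linarith
      have hs0 : 0 < s := ha.trans_le hsa
      obtain ⟨B', hB', hle'⟩ := ih (by omega) s' rfl
      obtain ⟨B, hB, hle⟩ := h.exists_measure_symmDiff_le hCD hs0 hss hs'1
        (δ := 1 / (N : ℝ) ^ 2) (by positivity) (by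
          rw [hdiff, show (1 / (N : ℝ) ^ 2)⁻¹ * (1 / (N : ℝ) ^ 2)⁻¹ = (N : ℝ) ^ 4 by
            field_simp, add_assoc]
          refine h1.trans_le (mul_le_mul_of_nonneg_right ?_ (Real.log_pos one_lt_two).le)
          have : (s : ℝ) ≤ b := by linarith
          exact mul_le_mul hsa (by linarith) (by linarith) (ha0.le.trans hsa)) hB'
      refine ⟨B, hB, (measure_symmDiff_le _ (Geo.eval s' ⁻¹' B') _).trans ?_⟩
      push_cast
      rw [add_mul, one_mul]
      exact add_le_add hle' hle
  obtain ⟨B, hB, hle⟩ := hchain N le_rfl a (by field_simp; ring)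
  refine ⟨B, hB, hle.trans_lt (lt_of_eq_of_lt ?_ h2)⟩
  rw [← ENNReal.ofReal_natCast N, ← ENNReal.ofReal_ofNat 3, ← ENNReal.ofReal_mul (by norm_num),
    ← ENNReal.ofReal_mul hN0.le]
  congr 1
  field_simp

/-- Almost surely, the position at time `a` determines the position at any later time `b`. -/
lemma IsTame.exists_ae_mem_iff (hCD : IsStrongCD K m) (h : IsTame m C D R P) {a b : I}
    (ha : 0 < a) (hab : a < b) (hb : b < 1) {A : Set X} (hA : MeasurableSet A) :
    ∃ B, MeasurableSet B ∧ ∀ᵐ γ ∂P, Geo.eval b γ ∈ A ↔ Geo.eval a γ ∈ B := by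
  obtain ⟨u, hu0, hu⟩ := ENNReal.exists_pos_sum_of_countable' one_ne_zero ℕ
  choose B hB hlt using fun n => h.exists_measure_symmDiff_lt hCD ha hab hb hA (hu0 n).ne'
  -- By Borel–Cantelli, almost every geodesic is misjudged by only finitely many `B k`, so their
  -- limsup decides exactly.
  refine ⟨⋂ n, ⋃ k ≥ n, B k, MeasurableSet.iInter fun n => MeasurableSet.iUnion fun k =>
    MeasurableSet.iUnion fun _ => hB k, ?_⟩
  have hsum : ∑' n, P ((Geo.eval b ⁻¹' A) ∆ (Geo.eval a ⁻¹' B n)) ≠ ∞ :=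
    ((ENNReal.tsum_le_tsum fun n => (hlt n).le).trans_lt (hu.trans ENNReal.one_lt_top)).ne
  filter_upwards [ae_eventually_notMem hsum] with γ hγ
  obtain ⟨N, hN⟩ := Filter.eventually_atTop.1 hγ
  have hiff (k : ℕ) (hk : N ≤ k) : Geo.eval b γ ∈ A ↔ Geo.eval a γ ∈ B k := by
    have := hN k hk
    simp only [mem_symmDiff, mem_preimage] at this
    tauto
  simp only [mem_iInter, mem_iUnion]
  refine ⟨fun hγA n => ⟨max n N, le_max_left _ _, (hiff _ (le_max_right _ _)).1 hγA⟩,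
    fun hγB => ?_⟩
  obtain ⟨k, hk, hkB⟩ := hγB N
  exact (hiff k hk).2 hkB

end Determinism

/-! ### From determinism to non-branching sets; reduction to tame plans -/

section NonBranching

variable {X : Type*} [MetricSpace X]

lemma Geo.ext_eval {γ η : Geo X} (h : ∀ t, Geo.eval t γ = Geo.eval t η) : γ = η :=
  Subtype.ext (ContinuousMap.ext h)

/-- Geodesics that agree on an initial interval and at a dense set of later times are equal. -/
lemma Geo.eq_of_eqOn_dense {γ η : Geo X} {T : Set I} (hT : Dense T) {a t : I} (ht : t < 1)
    (hat : a < t) (h₀ : ∀ s ∈ Icc (0 : I) t, γ s = η s) (h₁ : ∀ s ∈ T, a < s → s < 1 → γ s = η s) :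
    γ = η := by
  have hclosed : IsClosed {s : I | γ s = η s} :=
    isClosed_eq γ.1.continuous η.1.continuous
  have hIcc : Icc a 1 ⊆ {s : I | γ s = η s} := by
    rw [← closure_Ioo (hat.trans ht).ne]
    refine closure_minimal ((hT.open_subset_closure_inter isOpen_Ioo).trans ?_) hclosed
    exact closure_minimal (fun s hs => h₁ s hs.2 hs.1.1 hs.1.2) hclosed
  refine Geo.ext_eval fun s => ?_
  rcases le_total s t with hs | hs
  · exact h₀ s ⟨s.2.1, hs⟩
  · exact hIcc ⟨hat.le.trans hs, s.2.2⟩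

variable [MeasurableSpace X] [BorelSpace X]

/-- A union of non-branching sets may branch. Taking instead the geodesics that lie in all `Γ n`
from some index on puts any two of them in a common `Γ n`; monotonicity of `G` keeps this set of
full measure. -/
lemma exists_nonBranching_of_exhaustion {π : Measure (Geo X)} [IsProbabilityMeasure π]
    {G Γ : ℕ → Set (Geo X)} (hG : ∀ n, MeasurableSet (G n)) (hmono : Monotone G)
    (hcover : π (⋃ n, G n)ᶜ = 0) (hΓ : ∀ n, MeasurableSet (Γ n))
    (hnb : ∀ n, IsNonBranching (Γ n)) (hfull : ∀ n, π (G n \ Γ n) = 0) :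
    ConcentratedOnNonBranching π := by
  set Λ : Set (Geo X) := ⋃ N, G N ∩ ⋂ n ≥ N, Γ n with hΛ
  have hΛm : MeasurableSet Λ := MeasurableSet.iUnion fun N => (hG N).inter
    (MeasurableSet.iInter fun n => MeasurableSet.iInter fun _ => hΓ n)
  refine ⟨Λ, hΛm, ?_, ?_⟩
  · intro γ hγ η hη hex
    simp only [hΛ, mem_iUnion, mem_inter_iff, mem_iInter] at hγ hη
    obtain ⟨N, -, hN⟩ := hγ
    obtain ⟨N', -, hN'⟩ := hη
    exact hnb (max N N') γ (hN _ (le_max_left _ _)) η (hN' _ (le_max_right _ _)) hex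
  · rw [prob_compl_eq_zero_iff hΛm |>.symm]
    refine measure_mono_null ?_
      (measure_union_null hcover (measure_iUnion_null hfull))
    intro γ hγ
    by_contra hcon
    rw [mem_union, not_or, notMem_compl_iff] at hcon
    obtain ⟨N, hN⟩ := mem_iUnion.1 hcon.1
    refine hγ (mem_iUnion.2 ⟨N, hN, mem_iInter₂.2 fun n hn => ?_⟩)
    by_contra hΓn
    exact hcon.2 (mem_iUnion.2 ⟨n, hmono hn hN, hΓn⟩)

variable [SecondCountableTopology X] [CompleteSpace X] {m : Measure X} [SigmaFinite m]

/-- `Γ` imposes the almost sure equivalences for all pairs of times in a countable dense set and all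
basic open sets. If two members agree on `[0, t]`, choose such a time `a` in `(0, t)`: at every
later such time they lie in the same basic open sets, hence coincide. -/
lemma IsTame.exists_isNonBranching {C : Set X} {D R K : ℝ} {P : Measure (Geo X)}
    (hCD : IsStrongCD K m) (h : IsTame m C D R P) :
    ∃ Γ : Set (Geo X), MeasurableSet Γ ∧ IsNonBranching Γ ∧ P Γᶜ = 0 := by
  obtain ⟨T, hTc, hTd⟩ := TopologicalSpace.exists_countable_dense I
  have hUc := TopologicalSpace.countable_countableBasis X
  set 𝒰 := TopologicalSpace.countableBasis X with h𝒰
  have hUo (U : 𝒰) : IsOpen (U : Set X) := TopologicalSpace.isOpen_of_mem_countableBasis U.2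
  have : Countable T := hTc
  have : Countable 𝒰 := hUc
  let J := {p : T × T × 𝒰 // 0 < (p.1 : I) ∧ (p.1 : I) < p.2.1 ∧ (p.2.1 : I) < 1}
  choose B hB hae using fun j : J => h.exists_ae_mem_iff hCD j.2.1 j.2.2.1 j.2.2.2
    (hUo j.1.2.2).measurableSet
  let Γ : Set (Geo X) := ⋂ j : J,
    {γ | Geo.eval j.1.2.1 γ ∈ (j.1.2.2 : Set X) ↔ Geo.eval j.1.1 γ ∈ B j}
  have hΓ : MeasurableSet Γ := MeasurableSet.iInter fun j =>
    (Geo.measurable_eval _ (hUo j.1.2.2).measurableSet).iff (Geo.measurable_eval _ (hB j))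
  refine ⟨Γ, hΓ, ?_, ?_⟩
  · rintro γ hγ η hη ⟨t, ht, heq⟩
    obtain ⟨a, ⟨ha0, hat⟩, haT⟩ := hTd.inter_open_nonempty _ isOpen_Ioo (nonempty_Ioo.2 ht.1)
    refine Geo.eq_of_eqOn_dense hTd ht.2 hat heq fun s hs has hs1 => ?_
    have hiff (U : Set X) (hU : U ∈ 𝒰) : γ s ∈ U ↔ η s ∈ U := by
      let j : J := ⟨(⟨a, haT⟩, ⟨s, hs⟩, ⟨U, hU⟩), ha0, has, hs1⟩
      have h1 : γ s ∈ U ↔ γ a ∈ B j := mem_iInter.1 hγ j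
      have h2 : η s ∈ U ↔ η a ∈ B j := mem_iInter.1 hη j
      rw [h1, h2, heq a ⟨a.2.1, hat.le⟩]
    by_contra hne
    have hbasis := TopologicalSpace.isBasis_countableBasis X
    obtain ⟨U, hU, hmem, hsub⟩ := hbasis.exists_subset_of_mem_open
      (show γ s ∈ ({η s}ᶜ : Set X) from hne) isOpen_compl_singleton
    exact hsub ((hiff U hU).1 hmem) rfl
  · rw [← mem_ae_iff]
    exact (countable_iInter_mem).2 hae

instance : CompleteSpace (Geo X) := by
  have hcl : IsClosed {γ : C(I, X) |
      ∀ s t : I, dist (γ s) (γ t) = |(s : ℝ) - (t : ℝ)| * dist (γ 0) (γ 1)} := by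
    simp only [ofPred_forall]
    refine isClosed_iInter fun s => isClosed_iInter fun t => isClosed_eq ?_ ?_
    · exact (continuous_eval_const s).dist (continuous_eval_const t)
    · exact continuous_const.mul ((continuous_eval_const 0).dist (continuous_eval_const 1))
  exact hcl.completeSpace_coe

/-- Finite measures on the complete separable space `Geo X` are tight. -/
lemma exists_monotone_isCompact (π : Measure (Geo X)) [IsFiniteMeasure π] :
    ∃ 𝒦 : ℕ → Set (Geo X), (∀ n, IsCompact (𝒦 n)) ∧ Monotone 𝒦 ∧ π (⋃ n, 𝒦 n)ᶜ = 0 := by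
  have htight := isTightMeasureSet_singleton (μ := π)
  rw [isTightMeasureSet_iff_exists_isCompact_measure_compl_le] at htight
  choose L hLc hL using fun n : ℕ => htight ((n : ℝ≥0∞) + 1)⁻¹ (by simp)
  refine ⟨accumulate L, fun n => ?_, monotone_accumulate, ?_⟩
  · exact (finite_Iic n).isCompact_biUnion fun k _ => hLc k
  · rw [iUnion_accumulate]
    refine le_antisymm (le_of_forall_pos_le_add fun ε hε => ?_) zero_le
    obtain ⟨n, hn⟩ := ENNReal.exists_inv_nat_lt hε.ne'
    rw [zero_add]
    calc π (⋃ n, L n)ᶜ ≤ π (L n)ᶜ := measure_mono (compl_subset_compl.2 (subset_iUnion L n))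
      _ ≤ ((n : ℝ≥0∞) + 1)⁻¹ := hL n π rfl
      _ ≤ (n : ℝ≥0∞)⁻¹ := ENNReal.inv_le_inv' le_self_add
      _ ≤ ε := hn.le

lemma exists_isCompact_forall_eval_mem {𝒦 : Set (Geo X)} (h𝒦 : IsCompact 𝒦) :
    ∃ C : Set X, IsCompact C ∧ ∀ γ ∈ 𝒦, ∀ t, Geo.eval t γ ∈ C := by
  refine ⟨(fun p : Geo X × I => Geo.eval p.2 p.1) '' (𝒦 ×ˢ univ), ?_,
    fun γ hγ t => ⟨(γ, t), ⟨hγ, mem_univ t⟩, rfl⟩⟩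
  refine (h𝒦.prod isCompact_univ).image ?_
  exact continuous_eval.comp ((continuous_subtype_val.comp continuous_fst).prodMk continuous_snd)

lemma map_restrict_le_smul {π : Measure (Geo X)} {μ : Measure X} [SigmaFinite μ] {t : I}
    (hμ : π.map (Geo.eval t) = μ) (hac : μ ≪ m) {G : Set (Geo X)} {r : ℝ≥0∞}
    (hG : ∀ γ ∈ G, μ.rnDeriv m (Geo.eval t γ) ≤ r) :
    (π.restrict G).map (Geo.eval t) ≤ r • m := by
  have hS : MeasurableSet {x | μ.rnDeriv m x ≤ r} :=
    measurableSet_le (Measure.measurable_rnDeriv μ m) measurable_const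
  refine Measure.le_iff.2 fun s hs => ?_
  rw [Measure.map_apply (Geo.measurable_eval t) hs,
    Measure.restrict_apply (Geo.measurable_eval t hs)]
  calc π (Geo.eval t ⁻¹' s ∩ G) ≤ π (Geo.eval t ⁻¹' (s ∩ {x | μ.rnDeriv m x ≤ r})) :=
        measure_mono fun γ hγ => ⟨hγ.1, hG γ hγ.2⟩
    _ = μ (s ∩ {x | μ.rnDeriv m x ≤ r}) := by
        rw [← hμ, Measure.map_apply (Geo.measurable_eval t) (hs.inter (hμ ▸ hS))]
    _ = ∫⁻ x in s ∩ {x | μ.rnDeriv m x ≤ r}, μ.rnDeriv m x ∂m :=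
        (Measure.setLIntegral_rnDeriv hac _).symm
    _ ≤ ∫⁻ _ in s ∩ {x | μ.rnDeriv m x ≤ r}, r ∂m :=
        setLIntegral_mono measurable_const fun x hx => hx.2
    _ ≤ r * m s := by
        rw [setLIntegral_const]
        gcongr
        exact inter_subset_left
    _ = (r • m) s := rfl

/-- Conditioning on `G` multiplies the measure by at most `(π G)⁻¹`, which preserves optimality and
bounded densities. The geodesics of a compact family sweep out a compact set, of finite measure by
local finiteness. -/
lemma isTame_restrict [IsLocallyFiniteMeasure m] {μ₀ μ₁ : Measure X} (h₀ : IsP2 μ₀)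
    (h₁ : IsP2 μ₁) (hac₀ : μ₀ ≪ m) (hac₁ : μ₁ ≪ m) {π : Measure (Geo X)} (hπ : π ∈ OptGeo μ₀ μ₁)
    {𝒦 G : Set (Geo X)} (h𝒦 : IsCompact 𝒦) (hGm : MeasurableSet G) (hG𝒦 : G ⊆ 𝒦) {n : ℕ}
    (hG₀ : ∀ γ ∈ G, μ₀.rnDeriv m (Geo.eval 0 γ) ≤ n)
    (hG₁ : ∀ γ ∈ G, μ₁.rnDeriv m (Geo.eval 1 γ) ≤ n) (hG : π G ≠ 0) :
    ∃ (C : Set X) (D R : ℝ), IsTame m C D R ((π G)⁻¹ • π.restrict G) := by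
  have := h₀.isProbabilityMeasure
  have := h₁.isProbabilityMeasure
  obtain ⟨hπp, hm₀, hm₁, hopt⟩ := mem_optGeo_iff.1 hπ
  obtain ⟨C, hC, hCmem⟩ := exists_isCompact_forall_eval_mem h𝒦
  obtain ⟨D, hD⟩ := Metric.isBounded_iff.1 hC.isBounded
  have hfin : π G ≠ ∞ := measure_ne_top _ _
  have hprob : IsProbabilityMeasure ((π G)⁻¹ • π.restrict G) :=
    ⟨by simp [ENNReal.inv_mul_cancel hG hfin]⟩
  set c := ((π G)⁻¹).toReal with hc
  have hcG : ENNReal.ofReal c = (π G)⁻¹ := ENNReal.ofReal_toReal (ENNReal.inv_ne_top.2 hG)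
  have hc0 : 0 ≤ c := ENNReal.toReal_nonneg
  -- The summand `1` keeps the density bound positive when `n = 0`.
  have hbound {t : I} (h : (π.restrict G).map (Geo.eval t) ≤ (n : ℝ≥0∞) • m) :
      ((π G)⁻¹ • π.restrict G).map (Geo.eval t) ≤ ENNReal.ofReal (c * n + 1) • m := by
    intro s
    have hle : (π G)⁻¹ * n ≤ ENNReal.ofReal (c * n + 1) := by
      rw [← hcG, ← ENNReal.ofReal_natCast, ← ENNReal.ofReal_mul hc0]
      exact ENNReal.ofReal_le_ofReal (by linarith)
    rw [Measure.map_smul, Measure.smul_apply, Measure.smul_apply, smul_eq_mul, smul_eq_mul]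
    calc (π G)⁻¹ * (π.restrict G).map (Geo.eval t) s ≤ (π G)⁻¹ * (n * m s) :=
          mul_le_mul_right (h s) _
      _ = (π G)⁻¹ * n * m s := (mul_assoc _ _ _).symm
      _ ≤ _ := mul_le_mul_left hle _
  refine ⟨C, D, c * n + 1, hprob, hC.measurableSet, hC.measure_lt_top.ne,
    fun x hx y hy => hD hx hy, by positivity, ?_, ?_, ?_, ?_⟩
  · refine Measure.ae_smul_measure ?_ _
    filter_upwards [ae_restrict_mem hGm] with γ hγ
    exact hCmem γ (hG𝒦 hγ)
  · exact optimal_of_le_smul hopt (hopt.cost_lt_top h₀ h₁) (ENNReal.inv_ne_zero.2 hfin)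
      (ENNReal.inv_ne_top.2 hG) fun s => mul_le_mul_right (Measure.restrict_le_self s) _
  · exact hbound (map_restrict_le_smul hm₀ hac₀ hG₀)
  · exact hbound (map_restrict_le_smul hm₁ hac₁ hG₁)

theorem IsStrongCD.isEssentiallyNonBranching [IsLocallyFiniteMeasure m] {K : ℝ}
    (hCD : IsStrongCD K m) : IsEssentiallyNonBranching m := by
  intro μ₀ μ₁ h₀ h₁ hac₀ hac₁ π hπ
  have := h₀.isProbabilityMeasure
  have := h₁.isProbabilityMeasure
  obtain ⟨hπp, hm₀, hm₁, -⟩ := mem_optGeo_iff.1 hπ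
  obtain ⟨𝒦, h𝒦c, h𝒦m, h𝒦⟩ := exists_monotone_isCompact π
  let G : ℕ → Set (Geo X) := fun n => 𝒦 n ∩
    ({γ | μ₀.rnDeriv m (Geo.eval 0 γ) ≤ n} ∩ {γ | μ₁.rnDeriv m (Geo.eval 1 γ) ≤ n})
  have hmeas (t : I) (μ : Measure X) (n : ℕ) :
      MeasurableSet {γ : Geo X | μ.rnDeriv m (Geo.eval t γ) ≤ n} :=
    measurableSet_le ((Measure.measurable_rnDeriv μ m).comp (Geo.measurable_eval t))
      measurable_const
  have hG : ∀ n, MeasurableSet (G n) := fun n =>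
    (h𝒦c n).measurableSet.inter ((hmeas 0 μ₀ n).inter (hmeas 1 μ₁ n))
  have hmono : Monotone G := fun k n hkn γ hγ => by
    have hkn' : (k : ℝ≥0∞) ≤ n := by exact_mod_cast hkn
    exact ⟨h𝒦m hkn hγ.1, le_trans hγ.2.1 hkn', le_trans hγ.2.2 hkn'⟩
  have hcover : π (⋃ n, G n)ᶜ = 0 := by
    rw [← mem_ae_iff]
    have hlt {t : I} {μ : Measure X} [SigmaFinite μ] (hm : π.map (Geo.eval t) = μ)
        (hac : μ ≪ m) : ∀ᵐ γ ∂π, μ.rnDeriv m (Geo.eval t γ) < ∞ :=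
      ae_of_ae_map (p := fun x => μ.rnDeriv m x < ∞) (Geo.measurable_eval t).aemeasurable
        (by rw [hm]; exact hac.ae_le (μ.rnDeriv_lt_top m))
    filter_upwards [hlt hm₀ hac₀, hlt hm₁ hac₁, mem_ae_iff.2 h𝒦] with γ hγ₀ hγ₁ hγ
    obtain ⟨k, hk⟩ := mem_iUnion.1 hγ
    obtain ⟨n₀, hn₀⟩ := ENNReal.exists_nat_gt hγ₀.ne
    obtain ⟨n₁, hn₁⟩ := ENNReal.exists_nat_gt hγ₁.ne
    refine mem_iUnion.2 ⟨max k (max n₀ n₁), h𝒦m (le_max_left _ _) hk, ?_, ?_⟩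
    · refine hn₀.le.trans ?_
      exact_mod_cast (le_max_left n₀ n₁).trans (le_max_right _ _)
    · refine hn₁.le.trans ?_
      exact_mod_cast (le_max_right n₀ n₁).trans (le_max_right _ _)
  have hex (n : ℕ) : ∃ Γ : Set (Geo X), MeasurableSet Γ ∧ IsNonBranching Γ ∧
      π (G n \ Γ) = 0 := by
    rcases eq_or_ne (π (G n)) 0 with h0 | h0
    · exact ⟨∅, MeasurableSet.empty, fun γ hγ => hγ.elim, by simpa using h0⟩
    · obtain ⟨C, D, R, htame⟩ := isTame_restrict h₀ h₁ hac₀ hac₁ hπ (h𝒦c n) (hG n)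
        inter_subset_left (fun γ hγ => hγ.2.1) (fun γ hγ => hγ.2.2) h0
      obtain ⟨Γ, hΓ, hnb, hnull⟩ := htame.exists_isNonBranching hCD
      refine ⟨Γ, hΓ, hnb, ?_⟩
      rw [Measure.smul_apply, smul_eq_mul, mul_eq_zero,
        Measure.restrict_apply hΓ.compl] at hnull
      rw [Set.sdiff_eq, inter_comm]
      exact hnull.resolve_left (ENNReal.inv_ne_zero.2 (measure_ne_top _ _))
  choose Γ hΓ hnb hfull using hex
  exact exists_nonBranching_of_exhaustion hG hmono hcover hΓ hnb hfull

end NonBranching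

end OptTransport

theorem theorem1p1 {X : Type*} [MetricSpace X] [CompleteSpace X]
    [TopologicalSpace.SeparableSpace X] [MeasurableSpace X] [BorelSpace X]
    (hgeo : OptTransport.IsGeodesicSpace X)
    (m : MeasureTheory.Measure X) [MeasureTheory.IsLocallyFiniteMeasure m]
    (K : ℝ) (hCD : OptTransport.IsStrongCD K m) :
    OptTransport.IsEssentiallyNonBranching m := by
  have : SecondCountableTopology X := UniformSpace.secondCountable_of_separable X
  exact hCD.isEssentiallyNonBranching
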